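/- Let $n\in\{2,3\}$, $\gamma>1$, $0<\varepsilon<T$, and let $\mathbb T^n=\mathbb R^n/\mathbb Z^n$. Write $A>0$ for a symmetric positive definite matrix $A$. Let $u^\varepsilon\in C^\infty([0,T-\varepsilon]\times\mathbb T^n;\mathbb R^n)$, $\pi^\varepsilon\in C^\infty([0,T-\varepsilon]\times\mathbb T^n)$ and $R^\varepsilon\in C^\infty([0,T-\varepsilon]\times\mathbb T^n;\mathbb S^{n\times n})$ (symmetric matrices) be a smooth incompressible subsolution, that is, on $[0,T-\varepsilon]\times\mathbb T^n$ $$\partial_t u^\varepsilon+u^\varepsilon\cdot\nabla u^\varepsilon+\nabla\pi^\varepsilon+\operatorname{div}R^\varepsilon=0,\qquad \operatorname{div}u^\varepsilon=0,\qquad R^\varepsilon-\tfrac{\varepsilon}{4}\mathrm{Id}_n>0 .$$ Then there is $\delta_0>0$ (depending on $n,\gamma,T,\varepsilon$ and $(u^\varepsilon,\pi^\varepsilon,R^\varepsilon)$) such that for every $0<\delta\le\delta_0$ the following holds. There is a function $K_*=K_*(\delta,t)>0$ of $t\in[0,T-\varepsilon]$ such that $\delta^2\pi^\varepsilon+K_*>0$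 on $[0,T-\varepsilon]\times\mathbb T^n$ and $$\varrho_{\delta,K_*}:=\frac{(\delta^2\pi^\varepsilon+K_*)^{1/\gamma}-1}{\delta^2}\quad\text{satisfies}\quad \frac1{|\mathbb T^n|}\int_{\mathbb T^n}\varrho_{\delta,K_*}(t,x)\,dx=0\ \text{ for all } t\in[0,T-\varepsilon];$$ and, with $$\rho_\delta:=1+\delta^2\varrho_{\delta,K_*}=(\delta^2\pi^\varepsilon+K_*)^{1/\gamma},$$ there exist $v_\delta\in C^\infty([0,T-\varepsilon]\times\mathbb T^n;\mathbb R^n)$ and $\tilde R_\delta\in C^\infty([0,T-\varepsilon]\times\mathbb T^n;\mathbb S^{n\times n})$ with $\tilde R_\delta>0$ everywhere, such that $(\rho_\delta,\rho_\delta v_\delta,R^\varepsilon+\tilde R_\delta)$ is a smooth compressible subsolution: $\rho_\delta$ is smooth and positive, $R^\varepsilon+\tilde R_\delta>0$, and on $[0,T-\varepsilon]\times\mathbb T^n$ $$\partial_t\rho_\delta+\operatorname{div}(\rho_\delta v_\delta)=0,\qquad \partial_t(\rho_\delta v_\delta)+\operatorname{div}(\rho_\delta v_\delta\otimes v_\delta)+\nabla\frac{\rho_\delta^\gamma}{\delta^2}+\operatorname{div}(R^\varepsilon+\tilde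 R_\delta)=0 .$$ Moreover, with all norms taken over $[0,T-\varepsilon]\times\mathbb T^n$ and the Frobenius norm on matrices, $$\|\rho_\delta-1\|_{C^0}+\|\rho_\delta v_\delta-u^\varepsilon\|_{L^2}+\|\tilde R_\delta\|_{L^\infty}\le\varepsilon .$$ -/

import Mathlib

open Set MeasureTheory
open scoped ContDiff Matrix.Norms.Frobenius

noncomputable section

namespace LowMach

/-- `ℝⁿ` with its Euclidean norm. Functions on the torus `𝕋ⁿ = ℝⁿ / ℤⁿ` are represented by
functions on `ℝⁿ` that are `1`-periodic in every coordinate. -/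
abbrev E (n : ℕ) : Type := EuclideanSpace ℝ (Fin n)

/-- The `i`-th standard basis vector of `ℝⁿ`. -/
def basisVec {n : ℕ} (i : Fin n) : E n := EuclideanSpace.single i (1 : ℝ)

/-- The fundamental domain `[0,1)ⁿ` of the torus `𝕋ⁿ = ℝⁿ / ℤⁿ`. -/
def unitCube (n : ℕ) : Set (E n) := {x | ∀ i, x i ∈ Ico (0 : ℝ) 1}

/-- `f t` is a function on the torus for every `t ∈ [0, τ]`. -/
def PeriodicInSpace {n : ℕ} {F : Type*} (τ : ℝ) (f : ℝ → E n → F) : Prop :=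
  ∀ t ∈ Icc (0 : ℝ) τ, ∀ (x : E n) (i : Fin n), f t (x + basisVec i) = f t x

/-- `f ∈ C^∞([0, τ] × 𝕋ⁿ; F)`: jointly smooth in `(t, x)`, up to the end points of the
time interval, and periodic in `x`. Values of `f` at times outside `[0, τ]` are irrelevant.
(Spaces of matrices carry the Frobenius norm.) -/
def SmoothOnTorus {n : ℕ} {F : Type*} [NormedAddCommGroup F] [NormedSpace ℝ F]
    (τ : ℝ) (f : ℝ → E n → F) : Prop :=
  ContDiffOn ℝ ∞ (fun p : ℝ × E n => f p.1 p.2) (Icc (0 : ℝ) τ ×ˢ univ) ∧ PeriodicInSpace τ f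

/-- The time derivative `∂ₜ f (t, x)` on `[0, τ]`, one-sided at the end points. -/
def dt {n : ℕ} (τ : ℝ) (f : ℝ → E n → ℝ) (t : ℝ) (x : E n) : ℝ :=
  derivWithin (fun s => f s x) (Icc (0 : ℝ) τ) t

/-- The spatial partial derivative `∂ᵢ g (x)`. -/
def dx {n : ℕ} (i : Fin n) (g : E n → ℝ) (x : E n) : ℝ :=
  fderiv ℝ g x (basisVec i)

/-- The space-time domain `[0, τ] × 𝕋ⁿ`, with the torus replaced by its fundamental domain. -/
def spaceTime (n : ℕ) (τ : ℝ) : Set (ℝ × E n) := Icc (0 : ℝ) τ ×ˢ unitCube n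

/-- The norm of `L^p([0, τ] × 𝕋ⁿ; F)`, with values in `[0, ∞]`. -/
def LpNorm {n : ℕ} {F : Type*} [NormedAddCommGroup F] (p : ENNReal) (τ : ℝ)
    (f : ℝ → E n → F) : ENNReal :=
  eLpNorm (fun q : ℝ × E n => f q.1 q.2) p (volume.restrict (spaceTime n τ))

/-- The norm of `C⁰([0, τ] × 𝕋ⁿ; F)`, with values in `[0, ∞]`. -/
def supNorm {n : ℕ} {F : Type*} [NormedAddCommGroup F] (τ : ℝ)
    (f : ℝ → E n → F) : ENNReal :=
  ⨆ t ∈ Icc (0 : ℝ) τ, ⨆ x : E n, ‖f t x‖ₑ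

/-- `(u, π, R)` is a smooth incompressible subsolution on `[0, τ] × 𝕋ⁿ`:
`∂ₜ u + u · ∇u + ∇π + div R = 0`, `div u = 0`, with `R` symmetric and `R > (ε/4) Id`. -/
structure IsIncompressibleSubsolution {n : ℕ} (τ ε : ℝ) (u : ℝ → E n → E n)
    (π : ℝ → E n → ℝ) (R : ℝ → E n → Matrix (Fin n) (Fin n) ℝ) : Prop where
  smooth_u : SmoothOnTorus τ u
  smooth_π : SmoothOnTorus τ π
  smooth_R : SmoothOnTorus τ R
  momentum : ∀ t ∈ Icc (0 : ℝ) τ, ∀ (x : E n) (i : Fin n),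
    dt τ (fun s y => u s y i) t x
      + ∑ j, u t x j * dx j (fun y => u t y i) x
      + dx i (fun y => π t y) x
      + ∑ j, dx j (fun y => R t y i j) x = 0
  div_free : ∀ t ∈ Icc (0 : ℝ) τ, ∀ x : E n, ∑ j, dx j (fun y => u t y j) x = 0
  symm_R : ∀ t ∈ Icc (0 : ℝ) τ, ∀ x : E n, (R t x).IsSymm
  pos_R : ∀ t ∈ Icc (0 : ℝ) τ, ∀ x : E n,
    (R t x - (ε / 4) • (1 : Matrix (Fin n) (Fin n) ℝ)).PosDef

/-- `(ρ, ρ v, R)` is a smooth subsolution on `[0, τ] × 𝕋ⁿ` of the rescaled isentropic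
compressible Euler equations with adiabatic exponent `γ` and Mach number `δ`:
`∂ₜ ρ + div (ρ v) = 0` and `∂ₜ (ρ v) + div (ρ v ⊗ v) + ∇ (ρ^γ / δ²) + div R = 0`,
with `ρ > 0` and `R` symmetric positive definite. -/
structure IsCompressibleSubsolution {n : ℕ} (τ γ δ : ℝ) (ρ : ℝ → E n → ℝ)
    (v : ℝ → E n → E n) (R : ℝ → E n → Matrix (Fin n) (Fin n) ℝ) : Prop where
  smooth_ρ : SmoothOnTorus τ ρ
  smooth_v : SmoothOnTorus τ v
  smooth_R : SmoothOnTorus τ R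
  pos_ρ : ∀ t ∈ Icc (0 : ℝ) τ, ∀ x : E n, 0 < ρ t x
  pos_R : ∀ t ∈ Icc (0 : ℝ) τ, ∀ x : E n, (R t x).PosDef
  continuity : ∀ t ∈ Icc (0 : ℝ) τ, ∀ x : E n,
    dt τ ρ t x + ∑ j, dx j (fun y => ρ t y * v t y j) x = 0
  momentum : ∀ t ∈ Icc (0 : ℝ) τ, ∀ (x : E n) (i : Fin n),
    dt τ (fun s y => ρ s y * v s y i) t x
      + ∑ j, dx j (fun y => ρ t y * v t y i * v t y j) x
      + dx i (fun y => ρ t y ^ γ / δ ^ 2) x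
      + ∑ j, dx j (fun y => R t y i j) x = 0

/-- The profile `ϱ_{δ,K} = ((δ² π + K)^{1/γ} - 1) / δ²`, where `K` may depend on time. -/
def varrho {n : ℕ} (γ : ℝ) (π : ℝ → E n → ℝ) (δ : ℝ) (K : ℝ → ℝ) (t : ℝ) (x : E n) : ℝ :=
  ((δ ^ 2 * π t x + K t) ^ (1 / γ) - 1) / δ ^ 2

/-- `K` is the normalizing function `K_*(δ, ·)` on `[0, τ]`: for every `t` it is positive,
`δ² π + K > 0` on the torus, and `ϱ_{δ,K}` has zero average over the torus. -/
structure IsNormalizer {n : ℕ} (τ γ : ℝ) (π : ℝ → E n → ℝ) (δ : ℝ) (K : ℝ → ℝ) : Prop where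
  pos : ∀ t ∈ Icc (0 : ℝ) τ, 0 < K t
  base_pos : ∀ t ∈ Icc (0 : ℝ) τ, ∀ x : E n, 0 < δ ^ 2 * π t x + K t
  mean_zero : ∀ t ∈ Icc (0 : ℝ) τ, ⨍ x in unitCube n, varrho γ π δ K t x = 0

/-- The density `ρ_δ = 1 + δ² ϱ_{δ,K}`. -/
def density {n : ℕ} (γ : ℝ) (π : ℝ → E n → ℝ) (δ : ℝ) (K : ℝ → ℝ) (t : ℝ) (x : E n) : ℝ :=
  1 + δ ^ 2 * varrho γ π δ K t x

/-- For `δ ≠ 0` the density is `ρ_δ = (δ² π + K)^{1/γ}`. -/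
theorem density_eq {n : ℕ} (γ : ℝ) (π : ℝ → E n → ℝ) (δ : ℝ) (hδ : δ ≠ 0) (K : ℝ → ℝ)
    (t : ℝ) (x : E n) : density γ π δ K t x = (δ ^ 2 * π t x + K t) ^ (1 / γ) := by
  unfold density varrho
  field_simp
  ring

end LowMach

end

open LowMach

/-! Put `s = δ²` and treat `s ∈ [0, s₀]` as one more variable. For each `(s, t)` choose `K(s, t)` so
that `ρ = (sπ + K)^{1/γ}` has spatial mean 1. Monotonicity in the constant gives existence, and the
implicit function theorem gives joint smoothness up to `s = 0`, where `K = 1` and `ρ = 1`.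

Take as momentum `ρv = u + w`. As `div u = 0`, the continuity equation becomes `div w = -∂ₜρ`, which
is solvable because `∂ₜρ` has mean zero. Instead of inverting a Laplacian, average `∂ₜρ` over one
coordinate after another: with `Nₘ` the mean over the first `m` coordinates, `N₀ = ∂ₜρ`, `Nₙ = 0`,
and each difference `Nᵢ₊₁ - Nᵢ` is an `i`-th partial derivative of an explicit segment integral
`wᵢ`. The same device writes `∂ₜwᵢ = -∂ᵢσᵢ` (`exists_correction`).

Set `R̃ = u ⊗ u - ρ⁻¹(u + w) ⊗ (u + w) + diag σ + c Id`. Then `ρv ⊗ v + R̃ = u ⊗ u + diag σ + c Id`,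
while `∇(ρ^γ/δ²) = ∇π` because `K` does not depend on `x`, so the compressible momentum equation
reduces to the incompressible one (`isCompressibleSubsolution_of_correction`).

At `s = 0` the functions `ρ - 1`, `w`, `σ` and `R̃ - c Id` all vanish. They are continuous on a
domain that is compact modulo periods, hence uniformly small for small `s`
(`exists_uniformly_small`). The fixed term `c Id` makes `R̃` positive definite at a cost of at most
`ε/4` in norm. -/

namespace LowMach

open Filter Topology
open scoped Pointwise

/-! ### Weighted integrals along segments, with calculus on sets that need not be open. -/

section DirInt

variable {X : Type*} [NormedAddCommGroup X] [NormedSpace ℝ X]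
  {F : Type*} [NormedAddCommGroup F]

/-- `S` contains with every point `x` the segment `x + [0,1] e`. -/
def StableUnder (e : X) (S : Set X) : Prop :=
  ∀ x ∈ S, ∀ r ∈ Icc (0 : ℝ) 1, x + r • e ∈ S

variable {g : ℝ → ℝ} {e : X} {f : X → F} {S : Set X}

theorem StableUnder.continuousOn_line (hS : StableUnder e S) (hf : ContinuousOn f S) {x : X}
    (hx : x ∈ S) : ContinuousOn (fun r : ℝ => f (x + r • e)) (Icc 0 1) :=
  hf.comp (by fun_prop) fun r hr => hS x hx r hr

/-- Compactness of `[0, 1]` upgrades continuity at each point of the segment to an estimate uniform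
in `r`. -/
theorem StableUnder.eventually_uniform (hS : StableUnder e S) (hf : ContinuousOn f S) {x : X}
    (hx : x ∈ S) {η : ℝ} (hη : 0 < η) :
    ∀ᶠ y in 𝓝[S] x, ∀ r ∈ Icc (0 : ℝ) 1, ‖f (y + r • e) - f (x + r • e)‖ < η := by
  have key : ∀ᶠ y in 𝓝 x, ∀ r ∈ Icc (0 : ℝ) 1,
      y ∈ S → r ∈ Icc (0 : ℝ) 1 → ‖f (y + r • e) - f (x + r • e)‖ < η := by
    apply isCompact_Icc.eventually_forall_of_forall_eventually
    intro r hr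
    have hc : ContinuousOn (fun p : X × ℝ => f (p.1 + p.2 • e) - f (x + p.2 • e))
        (S ×ˢ Icc (0 : ℝ) 1) := by
      apply ContinuousOn.sub
      · exact hf.comp (by fun_prop) fun p hp => hS p.1 hp.1 p.2 hp.2
      · exact hf.comp (by fun_prop) fun p hp => hS x hx p.2 hp.2
    have h0 : Tendsto (fun p : X × ℝ => ‖f (p.1 + p.2 • e) - f (x + p.2 • e)‖)
        (𝓝[S ×ˢ Icc (0 : ℝ) 1] (x, r)) (𝓝 0) := by
      have := (hc.norm (x, r) ⟨hx, hr⟩).tendsto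
      simpa using this
    have h1 := h0.eventually (gt_mem_nhds hη)
    rw [eventually_nhdsWithin_iff] at h1
    filter_upwards [h1] with p hp h2 h3 using hp ⟨h2, h3⟩
  rw [eventually_nhdsWithin_iff]
  filter_upwards [key] with y hy hyS r hr using hy r hr hyS hr

variable [NormedSpace ℝ F]

/-- The weighted integral `∫₀¹ g(r) f(x + r e) dr` of `f` along the segment `x + [0,1] e`. -/
noncomputable def dirInt (g : ℝ → ℝ) (e : X) (f : X → F) (x : X) : F :=
  ∫ r in (0 : ℝ)..1, g r • f (x + r • e)

theorem StableUnder.intervalIntegrable (hS : StableUnder e S) (hg : Continuous g)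
    (hf : ContinuousOn f S) {x : X} (hx : x ∈ S) :
    IntervalIntegrable (fun r : ℝ => g r • f (x + r • e)) volume 0 1 := by
  apply ContinuousOn.intervalIntegrable
  rw [uIcc_of_le zero_le_one]
  exact hg.continuousOn.smul (hS.continuousOn_line hf hx)

theorem exists_bound_on_unitInterval (hg : Continuous g) :
    ∃ C : ℝ, 0 < C ∧ ∀ r ∈ Icc (0 : ℝ) 1, |g r| ≤ C := by
  obtain ⟨C, hC⟩ := isCompact_Icc.exists_bound_of_continuousOn (s := Icc (0 : ℝ) 1)
    hg.continuousOn
  exact ⟨max C 1, by positivity, fun r hr => (hC r hr).trans (le_max_left _ _)⟩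

theorem norm_integral_smul_le {G : ℝ → F} {C η : ℝ} (hC : ∀ r ∈ Icc (0 : ℝ) 1, |g r| ≤ C)
    (hC0 : 0 < C) (hG : ∀ r ∈ Icc (0 : ℝ) 1, ‖G r‖ ≤ η) :
    ‖∫ r in (0 : ℝ)..1, g r • G r‖ ≤ C * η := by
  have := intervalIntegral.norm_integral_le_of_norm_le_const (a := (0 : ℝ)) (b := 1)
    (f := fun r => g r • G r) (C := C * η) ?_
  · simpa using this
  · intro r hr
    rw [uIoc_of_le zero_le_one] at hr
    have hr' : r ∈ Icc (0 : ℝ) 1 := Ioc_subset_Icc_self hr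
    rw [norm_smul]
    exact mul_le_mul (hC r hr') (hG r hr') (norm_nonneg _) hC0.le

theorem StableUnder.continuousOn_dirInt (hS : StableUnder e S) (hg : Continuous g)
    (hf : ContinuousOn f S) : ContinuousOn (dirInt g e f) S := by
  intro x hx
  obtain ⟨C, hC0, hC⟩ := exists_bound_on_unitInterval hg
  rw [Metric.continuousWithinAt_iff']
  intro η hη
  have h := hS.eventually_uniform hf hx (η := η / (2 * C)) (by positivity)
  filter_upwards [h, self_mem_nhdsWithin] with y hy hyS
  rw [dist_eq_norm, dirInt, dirInt, ← intervalIntegral.integral_sub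
    (hS.intervalIntegrable hg hf hyS) (hS.intervalIntegrable hg hf hx)]
  simp_rw [← smul_sub]
  refine (norm_integral_smul_le hC hC0 fun r hr => (hy r hr).le).trans_lt ?_
  field_simp
  linarith

/-- On a small ball intersected with `S`, which is convex, `f'(· + r e)` is close to `f'(x + r e)`
uniformly in `r`. The mean value inequality then bounds the linearization error uniformly in `r`,
and the bound survives integration. -/
theorem StableUnder.hasFDerivWithinAt_dirInt [CompleteSpace F] (hS : StableUnder e S)
    (hconv : Convex ℝ S) (hg : Continuous g) {f' : X → X →L[ℝ] F}
    (hf : ∀ x ∈ S, HasFDerivWithinAt f (f' x) S x) (hf' : ContinuousOn f' S) {x : X}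
    (hx : x ∈ S) : HasFDerivWithinAt (dirInt g e f) (dirInt g e f' x) S x := by
  have hfc : ContinuousOn f S := fun x hx => (hf x hx).continuousWithinAt
  obtain ⟨C, hC0, hC⟩ := exists_bound_on_unitInterval hg
  rw [hasFDerivWithinAt_iff_isLittleO, Asymptotics.isLittleO_iff]
  intro η hη
  have h := hS.eventually_uniform hf' hx (η := η / C) (by positivity)
  rw [eventually_nhdsWithin_iff, Metric.eventually_nhds_iff_ball] at h
  obtain ⟨δ, hδ, hb⟩ := h
  have hball : Metric.ball x δ ∩ S ∈ 𝓝[S] x :=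
    inter_mem (mem_nhdsWithin_of_mem_nhds (Metric.ball_mem_nhds x hδ)) self_mem_nhdsWithin
  filter_upwards [hball] with y hy
  have hint' := hS.intervalIntegrable hg hf' hx
  have happ : (dirInt g e f' x) (y - x)
      = ∫ r in (0 : ℝ)..1, g r • (f' (x + r • e) (y - x)) := by
    rw [dirInt, ContinuousLinearMap.intervalIntegral_apply hint']
    rfl
  have hint2 : IntervalIntegrable (fun r : ℝ => g r • (f' (x + r • e) (y - x))) volume 0 1 :=
    hS.intervalIntegrable hg (hf'.clm_apply continuousOn_const) hx
  rw [happ, dirInt, dirInt, ← intervalIntegral.integral_sub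
    (hS.intervalIntegrable hg hfc hy.2) (hS.intervalIntegrable hg hfc hx),
    ← intervalIntegral.integral_sub ((hS.intervalIntegrable hg hfc hy.2).sub
      (hS.intervalIntegrable hg hfc hx)) hint2]
  simp_rw [← smul_sub]
  have key : ∀ r ∈ Icc (0 : ℝ) 1,
      ‖f (y + r • e) - f (x + r • e) - f' (x + r • e) (y - x)‖ ≤ η / C * ‖y - x‖ := by
    intro r hr
    have hd : ∀ z ∈ Metric.ball x δ ∩ S,
        HasFDerivWithinAt (fun z => f (z + r • e)) (f' (z + r • e)) (Metric.ball x δ ∩ S) z := by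
      intro z hz
      have h1 := (hf _ (hS z hz.2 r hr)).comp z
        ((hasFDerivWithinAt_id z (Metric.ball x δ ∩ S)).add_const (r • e))
        (fun w hw => hS w hw.2 r hr)
      simpa [Function.comp_def] using h1
    exact ((convex_ball x δ).inter hconv).norm_image_sub_le_of_norm_hasFDerivWithin_le' hd
      (fun z hz => (hb z hz.1 hz.2 r hr).le) ⟨Metric.mem_ball_self hδ, hx⟩ hy
  refine (norm_integral_smul_le hC hC0 key).trans (le_of_eq ?_)
  field_simp

/-- The derivative of a segment integral is the segment integral of the derivative, whose values lie
in `X →L[ℝ] F`. Hence the target varies in the induction, and `X` and `F` share a universe. -/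
theorem StableUnder.contDiffOn_dirInt_nat {X : Type} [NormedAddCommGroup X] [NormedSpace ℝ X]
    {e : X} {S : Set X} (hS : StableUnder e S) (hconv : Convex ℝ S) (hu : UniqueDiffOn ℝ S)
    (hg : Continuous g) (m : ℕ) :
    ∀ (F : Type) [NormedAddCommGroup F] [NormedSpace ℝ F] [CompleteSpace F] (f : X → F),
      ContDiffOn ℝ m f S → ContDiffOn ℝ m (dirInt g e f) S := by
  induction m with
  | zero =>
    intro F _ _ _ f hf
    exact contDiffOn_zero.2 (hS.continuousOn_dirInt hg hf.continuousOn)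
  | succ m ih =>
    intro F _ _ _ f hf
    push_cast at hf ⊢
    rw [contDiffOn_succ_iff_hasFDerivWithinAt_of_uniqueDiffOn hu] at hf ⊢
    obtain ⟨-, f', hf'c, hf'⟩ := hf
    exact ⟨by simp, dirInt g e f', ih _ f' hf'c, fun x hx =>
      hS.hasFDerivWithinAt_dirInt hconv hg hf' hf'c.continuousOn hx⟩

theorem StableUnder.contDiffOn_dirInt {X F : Type} [NormedAddCommGroup X] [NormedSpace ℝ X]
    [NormedAddCommGroup F] [NormedSpace ℝ F] [CompleteSpace F] {f : X → F}
    {e : X} {S : Set X} (hS : StableUnder e S) (hconv : Convex ℝ S) (hu : UniqueDiffOn ℝ S)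
    (hg : Continuous g) (hf : ContDiffOn ℝ ∞ f S) : ContDiffOn ℝ ∞ (dirInt g e f) S :=
  contDiffOn_infty.2 fun m => hS.contDiffOn_dirInt_nat hconv hu hg m F f
    (contDiffOn_infty.1 hf m)

/-- The derivative along `S` of `f` in the direction `v`. -/
noncomputable def derivAlong (S : Set X) (v : X) (f : X → F) (x : X) : F :=
  fderivWithin ℝ f S x v

theorem contDiffOn_derivAlong (hu : UniqueDiffOn ℝ S) (hf : ContDiffOn ℝ ∞ f S) (v : X) :
    ContDiffOn ℝ ∞ (derivAlong S v f) S :=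
  (hf.fderivWithin hu (by simp)).clm_apply contDiffOn_const

theorem StableUnder.derivAlong_dirInt [CompleteSpace F] (hS : StableUnder e S)
    (hconv : Convex ℝ S) (hu : UniqueDiffOn ℝ S) (hg : Continuous g) (hf : ContDiffOn ℝ ∞ f S)
    (v : X) {x : X} (hx : x ∈ S) :
    derivAlong S v (dirInt g e f) x = dirInt g e (derivAlong S v f) x := by
  have hd : ∀ x ∈ S, HasFDerivWithinAt f (fderivWithin ℝ f S x) S x := fun x hx =>
    (hf.differentiableOn (by simp) x hx).hasFDerivWithinAt
  have hc : ContinuousOn (fderivWithin ℝ f S) S :=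
    (hf.fderivWithin hu (m := 0) (by simp)).continuousOn
  have h := hS.hasFDerivWithinAt_dirInt hconv hg hd hc hx
  rw [derivAlong, h.fderivWithin (hu x hx), dirInt,
    ContinuousLinearMap.intervalIntegral_apply (hS.intervalIntegrable hg hc hx)]
  rfl

/-- The derivative of `f` along the line `r ↦ x + r e`. -/
theorem StableUnder.hasDerivWithinAt_line (hS : StableUnder e S) (hf : ContDiffOn ℝ ∞ f S)
    {x : X} (hx : x ∈ S) {r : ℝ} (hr : r ∈ Icc (0 : ℝ) 1) :
    HasDerivWithinAt (fun r : ℝ => f (x + r • e)) (derivAlong S e f (x + r • e)) (Icc 0 1) r := by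
  have hd := (hf.differentiableOn (by simp) _ (hS x hx r hr)).hasFDerivWithinAt
  have hl : HasDerivWithinAt (fun r : ℝ => x + r • e) e (Icc 0 1) r := by
    simpa using (((hasDerivAt_id r).smul_const e).const_add x).hasDerivWithinAt
  exact hd.comp_hasDerivWithinAt r hl (fun q hq => hS x hx q hq)

/-- Integration by parts along the segment. -/
theorem StableUnder.derivAlong_dirInt_self {f : X → ℝ} (hS : StableUnder e S)
    (hconv : Convex ℝ S) (hu : UniqueDiffOn ℝ S) {g' : ℝ → ℝ} (hg : ∀ r, HasDerivAt g (g' r) r)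
    (hg' : Continuous g') (hf : ContDiffOn ℝ ∞ f S) {x : X} (hx : x ∈ S) :
    derivAlong S e (dirInt g e f) x
      = g 1 * f (x + e) - g 0 * f x - dirInt g' e f x := by
  have hgc : Continuous g := continuous_iff_continuousAt.2 fun r => (hg r).continuousAt
  rw [hS.derivAlong_dirInt hconv hu hgc hf e hx]
  have hcd := (contDiffOn_derivAlong hu hf e).continuousOn
  have := intervalIntegral.integral_mul_deriv_eq_deriv_mul_of_hasDerivWithinAt
    (a := (0 : ℝ)) (b := 1) (u := g) (u' := g') (v := fun r => f (x + r • e))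
    (v' := fun r => derivAlong S e f (x + r • e))
    (fun r _ => (hg r).hasDerivWithinAt)
    (fun r hr => by
      rw [uIcc_of_le zero_le_one] at hr ⊢
      exact hS.hasDerivWithinAt_line hf hx hr)
    (hg'.intervalIntegrable _ _)
    (by
      apply ContinuousOn.intervalIntegrable
      rw [uIcc_of_le zero_le_one]
      exact hS.continuousOn_line hcd hx)
  simp only [dirInt, smul_eq_mul]
  rw [this]
  simp

end DirInt

/-! ### Periodic functions, and the torus average as an iterated coordinate mean. -/

section Torus

variable {n : ℕ}

/-- The standard basis of `ℝⁿ`. -/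
noncomputable abbrev stdBasis (n : ℕ) : Module.Basis (Fin n) ℝ (E n) :=
  (EuclideanSpace.basisFun (Fin n) ℝ).toBasis

/-- The lattice `ℤⁿ`. -/
noncomputable abbrev lattice (n : ℕ) : Submodule ℤ (E n) :=
  Submodule.span ℤ (range (stdBasis n))

theorem unitCube_eq : unitCube n = ZSpan.fundamentalDomain (stdBasis n) := by
  ext x
  simp [unitCube, ZSpan.mem_fundamentalDomain, EuclideanSpace.basisFun_repr]

theorem isAddFundamentalDomain_unitCube :
    IsAddFundamentalDomain (lattice n) (unitCube n) volume := by
  rw [unitCube_eq]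
  exact ZSpan.isAddFundamentalDomain _ _

theorem isBounded_unitCube : Bornology.IsBounded (unitCube n) := by
  rw [unitCube_eq]
  exact ZSpan.fundamentalDomain_isBounded _

theorem volume_unitCube_lt_top : volume (unitCube n) < ⊤ := isBounded_unitCube.measure_lt_top

theorem volume_unitCube_ne_zero : volume (unitCube n) ≠ 0 := by
  rw [unitCube_eq]
  exact ZSpan.measure_fundamentalDomain_ne_zero _

theorem measurableSet_unitCube : MeasurableSet (unitCube n) := by
  rw [unitCube_eq]
  exact ZSpan.fundamentalDomain_measurableSet _

/-- `f` is `1`-periodic in every coordinate. -/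
def IsPeriodic {F : Type*} (f : E n → F) : Prop := ∀ x i, f (x + basisVec i) = f x

theorem IsPeriodic.add_lattice {F : Type*} {f : E n → F} (hf : IsPeriodic f) {v : E n}
    (hv : v ∈ lattice n) : ∀ x, f (x + v) = f x := by
  induction hv using Submodule.span_induction with
  | mem v hv =>
    obtain ⟨i, rfl⟩ := hv
    intro x
    simpa [basisVec] using hf x i
  | zero => simp
  | add v w _ _ h1 h2 =>
    intro x
    rw [← add_assoc, h2, h1]
  | smul a v _ h =>
    have hp : Function.Periodic f v := h
    exact hp.zsmul a

theorem IsPeriodic.exists_mem_unitCube {F : Type*} {f : E n → F} (hf : IsPeriodic f)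
    (x : E n) : f (ZSpan.fract (stdBasis n) x) = f x := by
  have h := hf.add_lattice (ZSpan.floor (stdBasis n) x).2 (ZSpan.fract (stdBasis n) x)
  rw [← h]
  simp [ZSpan.fract]

theorem fract_mem_unitCube (x : E n) : ZSpan.fract (stdBasis n) x ∈ unitCube n := by
  rw [unitCube_eq]
  exact ZSpan.fract_mem_fundamentalDomain _ _

theorem IsPeriodic.exists_bound {f : E n → ℝ} (hf : IsPeriodic f) (hc : Continuous f) :
    ∃ C, ∀ x, ‖f x‖ ≤ C := by
  obtain ⟨C, hC⟩ := isBounded_unitCube.isCompact_closure.exists_bound_of_continuousOn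
    (s := closure (unitCube n)) hc.continuousOn
  refine ⟨C, fun x => ?_⟩
  rw [← hf.exists_mem_unitCube x]
  exact hC _ (subset_closure (fract_mem_unitCube x))

/-- A translate of the unit cube is again a fundamental domain of the lattice, and a periodic
function has the same integral over every fundamental domain. -/
theorem IsPeriodic.setIntegral_add_right {f : E n → ℝ} (hf : IsPeriodic f) (a : E n) :
    ∫ x in unitCube n, f (x + a) = ∫ x in unitCube n, f x := by
  have h1 := isAddFundamentalDomain_unitCube (n := n)
  have h2 := h1.vadd_of_comm a
  have h3 : ∫ x in a +ᵥ unitCube n, f x = ∫ x in unitCube n, f x := by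
    have : VAddInvariantMeasure (lattice n) (E n) volume :=
      ⟨fun v s _ => measure_preimage_add volume (v : E n) s⟩
    refine h2.setIntegral_eq h1 fun v x => ?_
    rw [Submodule.vadd_def, vadd_eq_add, add_comm, hf.add_lattice v.2]
  rw [← h3]
  have h4 := (measurePreserving_add_right (volume : Measure (E n)) a).setIntegral_image_emb
    (MeasurableEquiv.addRight a).measurableEmbedding f (unitCube n)
  rw [← h4]
  congr 2
  ext x
  simp [mem_vadd_set_iff_neg_vadd_mem, add_comm]

/-- The directions of the coordinate axes, extended by zero. -/
noncomputable def axis (n m : ℕ) : E n := if h : m < n then basisVec ⟨m, h⟩ else 0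

theorem axis_fin (i : Fin n) : axis n i = basisVec i := by simp [axis]

theorem IsPeriodic.add_axis {F : Type*} {f : E n → F} (hf : IsPeriodic f) (m : ℕ) (x : E n) :
    f (x + axis n m) = f x := by
  unfold axis
  split_ifs
  · exact hf _ _
  · simp

/-- The average of `f` over the first `m` of the segments `[0,1] e₀, [0,1] e₁, …`. -/
noncomputable def iterMean {X : Type*} [NormedAddCommGroup X] [NormedSpace ℝ X] (e : ℕ → X)
    (f : X → ℝ) : ℕ → X → ℝ
  | 0 => f
  | m + 1 => dirInt (fun _ => 1) (e m) (iterMean e f m)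

theorem continuous_dirInt {g : ℝ → ℝ} (hg : Continuous g) {e : E n} {f : E n → ℝ}
    (hf : Continuous f) : Continuous (dirInt g e f) := by
  rw [← continuousOn_univ] at hf ⊢
  exact StableUnder.continuousOn_dirInt (fun _ _ _ _ => mem_univ _) hg hf

theorem continuous_iterMean {f : E n → ℝ} (hf : Continuous f) (m : ℕ) :
    Continuous (iterMean (axis n) f m) := by
  induction m with
  | zero => exact hf
  | succ m ih => exact continuous_dirInt continuous_const ih

theorem IsPeriodic.dirInt {f : E n → ℝ} (hf : IsPeriodic f) (g : ℝ → ℝ) (e : E n) :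
    IsPeriodic (dirInt g e f) := by
  intro x i
  unfold LowMach.dirInt
  congr 1
  ext r
  rw [add_right_comm, hf]

theorem IsPeriodic.iterMean {f : E n → ℝ} (hf : IsPeriodic f) (m : ℕ) :
    IsPeriodic (iterMean (axis n) f m) := by
  induction m with
  | zero => exact hf
  | succ m ih => exact ih.dirInt _ _

/-- Fubini, followed by translation invariance of the integral over the cube for each fixed `r`. -/
theorem IsPeriodic.setIntegral_mean {f : E n → ℝ} (hf : IsPeriodic f) (hc : Continuous f)
    (e : E n) :
    ∫ x in unitCube n, LowMach.dirInt (fun _ => 1) e f x = ∫ x in unitCube n, f x := by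
  have : IsFiniteMeasure (volume.restrict (unitCube n)) :=
    ⟨by simpa using volume_unitCube_lt_top⟩
  obtain ⟨C, hC⟩ := hf.exists_bound hc
  simp only [LowMach.dirInt, one_smul, intervalIntegral.integral_of_le zero_le_one]
  rw [integral_integral_swap]
  · simp [hf.setIntegral_add_right]
  · apply Integrable.of_bound (C := C)
    · apply Continuous.aestronglyMeasurable
      unfold Function.uncurry
      fun_prop
    · exact ae_of_all _ fun p => hC _

theorem IsPeriodic.mean_add_smul {f : E n → ℝ} (hf : IsPeriodic f) (m : ℕ) (x : E n) (a : ℝ) :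
    LowMach.dirInt (fun _ => 1) (axis n m) f (x + a • axis n m)
      = LowMach.dirInt (fun _ => 1) (axis n m) f x := by
  have hp : Function.Periodic (fun r : ℝ => f (x + r • axis n m)) 1 := fun r => by
    simp only [add_smul, one_smul, ← add_assoc, hf.add_axis]
  have h := hp.intervalIntegral_add_eq a 0
  have h2 := intervalIntegral.integral_comp_add_left (a := 0) (b := 1)
    (fun r : ℝ => f (x + r • axis n m)) a
  simp only [LowMach.dirInt, one_smul]
  rw [zero_add] at h
  rw [add_zero] at h2
  rw [← h, ← h2]
  congr 1
  ext r
  rw [add_smul, add_assoc]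

theorem IsPeriodic.iterMean_add_smul {f : E n → ℝ} (hf : IsPeriodic f) (m j : ℕ) (hj : j < m)
    (x : E n) (a : ℝ) :
    LowMach.iterMean (axis n) f m (x + a • axis n j) = LowMach.iterMean (axis n) f m x := by
  induction m generalizing x with
  | zero => omega
  | succ m ih =>
    rcases Nat.lt_succ_iff_lt_or_eq.1 hj with h | rfl
    · change LowMach.dirInt _ _ _ _ = LowMach.dirInt _ _ _ _
      unfold LowMach.dirInt
      congr 1
      ext r
      rw [add_right_comm, ih h]
    · exact (hf.iterMean j).mean_add_smul j x a

/-- After all `n` averagings the function is invariant under arbitrary real translations along every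
axis, and the axes span. -/
theorem IsPeriodic.iterMean_const {f : E n → ℝ} (hf : IsPeriodic f) (x y : E n) :
    LowMach.iterMean (axis n) f n x = LowMach.iterMean (axis n) f n y := by
  have key : ∀ (s : Finset (Fin n)) (c : Fin n → ℝ),
      LowMach.iterMean (axis n) f n (y + ∑ i ∈ s, c i • basisVec i)
        = LowMach.iterMean (axis n) f n y := by
    intro s c
    induction s using Finset.induction_on with
    | empty => simp
    | insert i s hi ih =>
      rw [Finset.sum_insert hi, add_comm (c i • _), ← add_assoc, ← axis_fin i,
        hf.iterMean_add_smul n i i.2, ih]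
  have h := key Finset.univ fun i => (x - y) i
  have hsum : ∑ i, (x - y) i • (basisVec i : E n) = x - y := by
    have := (stdBasis n).sum_repr (x - y)
    simpa [basisVec, EuclideanSpace.basisFun_repr] using this
  rw [hsum] at h
  simpa using h

/-- The iterated mean over all coordinates is the average over the torus. -/
theorem IsPeriodic.iterMean_eq_average {f : E n → ℝ} (hf : IsPeriodic f) (hc : Continuous f)
    (x : E n) : LowMach.iterMean (axis n) f n x = ⨍ y in unitCube n, f y := by
  have h1 : ∀ m, ∫ y in unitCube n, LowMach.iterMean (axis n) f m y = ∫ y in unitCube n, f y := by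
    intro m
    induction m with
    | zero => rfl
    | succ m ih =>
      exact ((hf.iterMean m).setIntegral_mean (continuous_iterMean hc m) _).trans ih
  rw [setAverage_eq, ← h1 n]
  simp_rw [fun y => hf.iterMean_const y x]
  rw [setIntegral_const, smul_smul, inv_mul_cancel₀, one_smul]
  exact (ENNReal.toReal_ne_zero).2 ⟨volume_unitCube_ne_zero, volume_unitCube_lt_top.ne⟩

end Torus

/-! ### Scalar implicit functions over a domain with boundary. -/

section Implicit

variable {Y : Type*} [NormedAddCommGroup Y] [NormedSpace ℝ Y] {D : Set Y} {a b c : ℝ}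
  {H : Y × ℝ → ℝ} {K : Y → ℝ}

theorem strictMonoOn_of_derivAlong_pos (hH : ContDiffOn ℝ ∞ H (D ×ˢ Ioo a b))
    (hpos : ∀ p ∈ D ×ˢ Ioo a b, 0 < derivAlong (D ×ˢ Ioo a b) (0, 1) H p) {y : Y} (hy : y ∈ D) :
    StrictMonoOn (fun κ => H (y, κ)) (Ioo a b) := by
  have hd : ∀ κ ∈ Ioo a b,
      HasDerivAt (fun κ => H (y, κ)) (derivAlong (D ×ˢ Ioo a b) (0, 1) H (y, κ)) κ := by
    intro κ hκ
    have h1 := (hH.differentiableOn (by simp) (y, κ) ⟨hy, hκ⟩).hasFDerivWithinAt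
    have h2 : HasDerivWithinAt (fun κ : ℝ => (y, κ)) (0, 1) (Ioo a b) κ :=
      ((hasDerivAt_const κ y).prodMk (hasDerivAt_id κ)).hasDerivWithinAt
    exact (h1.comp_hasDerivWithinAt κ h2 fun q hq => ⟨hy, hq⟩).hasDerivAt
      (isOpen_Ioo.mem_nhds hκ)
  refine strictMonoOn_of_deriv_pos (convex_Ioo a b)
    (fun κ hκ => (hd κ hκ).continuousAt.continuousWithinAt) fun κ hκ => ?_
  rw [interior_Ioo] at hκ
  rw [(hd κ hκ).deriv]
  exact hpos _ ⟨hy, hκ⟩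

/-- Monotonicity traps the root: if `κ < K y` then `H (y, κ) < c`, an inequality that persists for
nearby `z` and forces `κ < K z`. The upper side is symmetric. -/
theorem continuousOn_implicit (hH : ContDiffOn ℝ ∞ H (D ×ˢ Ioo a b))
    (hpos : ∀ p ∈ D ×ˢ Ioo a b, 0 < derivAlong (D ×ˢ Ioo a b) (0, 1) H p)
    (hK : MapsTo K D (Ioo a b)) (hc : ∀ y ∈ D, H (y, K y) = c) : ContinuousOn K D := by
  have hm := fun y (hy : y ∈ D) => strictMonoOn_of_derivAlong_pos hH hpos hy
  have hcont : ∀ κ ∈ Ioo a b, ContinuousOn (fun y => H (y, κ)) D := fun κ hκ =>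
    hH.continuousOn.comp (by fun_prop) fun y hy => ⟨hy, hκ⟩
  intro y hy
  refine tendsto_order.2 ⟨fun l hl => ?_, fun l hl => ?_⟩
  · obtain ⟨κ, h1, h2⟩ := exists_between (max_lt hl (hK hy).1)
    have hκ : κ ∈ Ioo a b := ⟨(le_max_right _ _).trans_lt h1, h2.trans (hK hy).2⟩
    have h3 : H (y, κ) < c := by
      rw [← hc y hy]
      exact hm y hy hκ (hK hy) h2
    filter_upwards [(hcont κ hκ y hy).eventually (gt_mem_nhds h3), self_mem_nhdsWithin]
      with z hz hzD
    rw [← hc z hzD] at hz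
    exact ((le_max_left _ _).trans_lt h1).trans (((hm z hzD).lt_iff_lt hκ (hK hzD)).1 hz)
  · obtain ⟨κ, h1, h2⟩ := exists_between (lt_min hl (hK hy).2)
    have hκ : κ ∈ Ioo a b := ⟨(hK hy).1.trans h1, h2.trans_le (min_le_right _ _)⟩
    have h3 : c < H (y, κ) := by
      rw [← hc y hy]
      exact hm y hy (hK hy) hκ h1
    filter_upwards [(hcont κ hκ y hy).eventually (lt_mem_nhds h3), self_mem_nhdsWithin]
      with z hz hzD
    rw [← hc z hzD] at hz
    exact (((hm z hzD).lt_iff_lt (hK hzD) hκ).1 hz).trans (h2.trans_le (min_le_left _ _))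

/-- Linearize `H (z, K z) - H (y, K y) = 0` and solve for the increment of `K`. The error is small
relative to the joint increment, so its `K` part must be absorbed on the left. -/
theorem hasFDerivWithinAt_implicit {L : Y × ℝ →L[ℝ] ℝ} {J : Set ℝ} {y : Y} (hy : y ∈ D)
    (hH : HasFDerivWithinAt H L (D ×ˢ J) (y, K y)) (hL : L (0, 1) ≠ 0)
    (hK : MapsTo K D J) (hKc : ContinuousWithinAt K D y) (hc : ∀ y ∈ D, H (y, K y) = c) :
    HasFDerivWithinAt K (-(L (0, 1))⁻¹ • L.comp (ContinuousLinearMap.inl ℝ Y ℝ)) D y := by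
  set β := L (0, 1) with hβ
  set A := L.comp (ContinuousLinearMap.inl ℝ Y ℝ) with hA
  have hLs : ∀ (v : Y) (k : ℝ), L (v, k) = A v + k * β := by
    intro v k
    have : ((v, k) : Y × ℝ) = (v, 0) + k • (0, 1) := by simp
    rw [this, map_add, map_smul, smul_eq_mul]
    rfl
  rw [hasFDerivWithinAt_iff_isLittleO, Asymptotics.isLittleO_iff]
  intro η hη
  set N := ‖β⁻¹ • A‖ with hN
  have hN0 : 0 ≤ N := norm_nonneg _
  -- The bound `1/2` allows absorbing `θ‖q‖`; what remains is `‖q‖ ≤ 2θ(1 + N)‖z - y‖`, and the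
  -- second bound makes this at most `η‖z - y‖`.
  set θ := min (1 / 2) (η / (2 * (1 + N))) with hθ
  have hθ0 : 0 < θ := by positivity
  have htend : Tendsto (fun z => (z, K z)) (𝓝[D] y) (𝓝[D ×ˢ J] (y, K y)) := by
    refine tendsto_nhdsWithin_iff.2 ⟨?_, ?_⟩
    · exact (tendsto_nhdsWithin_of_tendsto_nhds tendsto_id).prodMk_nhds hKc
    · filter_upwards [self_mem_nhdsWithin] with z hz using ⟨hz, hK hz⟩
  have ho := hH.isLittleO.comp_tendsto htend
  have ho2 := (Asymptotics.isLittleO_iff.1 ho) (show 0 < |β| * θ by positivity)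
  filter_upwards [ho2, self_mem_nhdsWithin] with z hz hzD
  simp only [Function.comp_apply, hc z hzD, hc y hy, sub_self, zero_sub, norm_neg,
    Prod.mk_sub_mk, hLs] at hz
  set q := K z - K y + β⁻¹ * A (z - y) with hq
  have e1 : A (z - y) + (K z - K y) * β = β * q := by
    rw [hq]
    field_simp
    ring
  have hgoal : K z - K y - (-β⁻¹ • A) (z - y) = q := by
    rw [hq, smul_apply, smul_eq_mul]
    ring
  rw [hgoal]
  rw [e1, norm_mul, Real.norm_eq_abs, mul_assoc] at hz
  have hz1 : ‖q‖ ≤ θ * ‖(z - y, K z - K y)‖ := le_of_mul_le_mul_left hz (abs_pos.2 hL)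
  have hz2 : ‖(z - y, K z - K y)‖ ≤ ‖z - y‖ + ‖K z - K y‖ := by
    rw [Prod.norm_def]
    exact max_le_add_of_nonneg (norm_nonneg _) (norm_nonneg _)
  have hz3 : ‖K z - K y‖ ≤ ‖q‖ + N * ‖z - y‖ := by
    have : K z - K y = q - (β⁻¹ • A) (z - y) := by
      rw [hq, smul_apply, smul_eq_mul]
      ring
    rw [this]
    exact (norm_sub_le _ _).trans (by gcongr; exact ContinuousLinearMap.le_opNorm _ _)
  have hθ1 : θ ≤ 1 / 2 := min_le_left _ _
  have hθ2 : θ * (2 * (1 + N)) ≤ η := by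
    rw [← le_div_iff₀ (by positivity)]
    exact min_le_right _ _
  have hz4 : ‖q‖ ≤ θ * ((1 + N) * ‖z - y‖) + θ * ‖q‖ := by
    refine hz1.trans ?_
    rw [← mul_add]
    gcongr
    linarith
  have hz5 : θ * ‖q‖ ≤ 1 / 2 * ‖q‖ := by gcongr
  have hz6 : θ * (2 * (1 + N)) * ‖z - y‖ ≤ η * ‖z - y‖ := by gcongr
  linarith

/-- The implicit function theorem for a scalar unknown, on a domain that need not be open. -/
theorem contDiffOn_implicit (hD : UniqueDiffOn ℝ D) (hH : ContDiffOn ℝ ∞ H (D ×ˢ Ioo a b))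
    (hpos : ∀ p ∈ D ×ˢ Ioo a b, 0 < derivAlong (D ×ˢ Ioo a b) (0, 1) H p)
    (hK : MapsTo K D (Ioo a b)) (hc : ∀ y ∈ D, H (y, K y) = c) : ContDiffOn ℝ ∞ K D := by
  have hu : UniqueDiffOn ℝ (D ×ˢ Ioo a b) := hD.prod isOpen_Ioo.uniqueDiffOn
  have hcK := continuousOn_implicit hH hpos hK hc
  have hder := fun y (hy : y ∈ D) => hasFDerivWithinAt_implicit hy
    (hH.differentiableOn (by simp) (y, K y) ⟨hy, hK hy⟩).hasFDerivWithinAt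
    (hpos _ ⟨hy, hK hy⟩).ne' hK (hcK y hy) hc
  -- Bootstrap: the derivative formula expresses `K'` through the derivative of `H` at `(y, K y)`,
  -- so `K` of class `C^m` gives `K'` of class `C^m`.
  refine contDiffOn_infty.2 fun m => ?_
  induction m with
  | zero => exact contDiffOn_zero.2 hcK
  | succ m ih =>
    push_cast
    rw [contDiffOn_succ_iff_hasFDerivWithinAt_of_uniqueDiffOn hD]
    refine ⟨by simp, _, ?_, hder⟩
    have hf' : ContDiffOn ℝ m (fderivWithin ℝ H (D ×ˢ Ioo a b)) (D ×ˢ Ioo a b) :=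
      hH.fderivWithin hu (by exact_mod_cast le_top)
    have hcomp : ContDiffOn ℝ m (fun y => fderivWithin ℝ H (D ×ˢ Ioo a b) (y, K y)) D :=
      hf'.comp (contDiffOn_id.prodMk ih) fun y hy => ⟨hy, hK hy⟩
    have hinv : ContDiffOn ℝ m
        (fun y => -(fderivWithin ℝ H (D ×ˢ Ioo a b) (y, K y) (0, 1))⁻¹) D :=
      ((hcomp.clm_apply contDiffOn_const).inv fun y hy => (hpos _ ⟨hy, hK hy⟩).ne').neg
    exact hinv.smul (hcomp.clm_comp (contDiffOn_const (c := ContinuousLinearMap.inl ℝ Y ℝ)))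

end Implicit

/-! ### Order properties of the iterated mean. -/

section Mean

variable {n : ℕ}

theorem dirInt_mono {e : E n} {f g : E n → ℝ} (hf : Continuous f) (hg : Continuous g)
    (h : ∀ x, f x ≤ g x) (x : E n) :
    dirInt (fun _ => 1) e f x ≤ dirInt (fun _ => 1) e g x := by
  simp only [dirInt, one_smul]
  exact intervalIntegral.integral_mono zero_le_one
    (Continuous.intervalIntegrable (by fun_prop) _ _)
    (Continuous.intervalIntegrable (by fun_prop) _ _) fun r => h _

theorem iterMean_mono {f g : E n → ℝ} (hf : Continuous f) (hg : Continuous g)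
    (h : ∀ x, f x ≤ g x) (m : ℕ) (x : E n) :
    iterMean (axis n) f m x ≤ iterMean (axis n) g m x := by
  induction m generalizing x with
  | zero => exact h x
  | succ m ih => exact dirInt_mono (continuous_iterMean hf m) (continuous_iterMean hg m) ih x

theorem iterMean_fun_const (c : ℝ) (m : ℕ) (x : E n) :
    iterMean (axis n) (fun _ => c) m x = c := by
  induction m generalizing x with
  | zero => rfl
  | succ m ih => simp [iterMean, dirInt, ih]

theorem iterMean_pos {f : E n → ℝ} (hf : Continuous f) (h : ∀ x, 0 < f x) (m : ℕ) (x : E n) :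
    0 < iterMean (axis n) f m x := by
  induction m generalizing x with
  | zero => exact h x
  | succ m ih =>
    have hc := continuous_iterMean hf m
    simp only [iterMean, dirInt, one_smul]
    exact intervalIntegral.intervalIntegral_pos_of_pos
      (Continuous.intervalIntegrable (by fun_prop) _ _) (fun r => ih _) zero_lt_one

end Mean

/-! ### Iterated means with parameters. -/

section Product

variable {n : ℕ} {Y : Type} [NormedAddCommGroup Y] [NormedSpace ℝ Y] {D : Set Y}

theorem stableUnder_prod (D : Set Y) (e : E n) :
    StableUnder ((0, e) : Y × E n) (D ×ˢ (univ : Set (E n))) := by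
  intro x hx r _
  simpa using hx.1

/-- The axes of `ℝⁿ` in `Y × ℝⁿ`. -/
noncomputable def axisProd (Y : Type) [NormedAddCommGroup Y] (n m : ℕ) : Y × E n := (0, axis n m)

theorem dirInt_prod (g : ℝ → ℝ) (e : E n) (f : Y × E n → ℝ) (y : Y) (x : E n) :
    dirInt g ((0, e) : Y × E n) f (y, x) = dirInt g e (fun x => f (y, x)) x := by
  simp [dirInt]

theorem iterMean_prod (f : Y × E n → ℝ) (m : ℕ) (y : Y) (x : E n) :
    iterMean (axisProd Y n) f m (y, x) = iterMean (axis n) (fun x => f (y, x)) m x := by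
  induction m generalizing x with
  | zero => rfl
  | succ m ih =>
    simp only [iterMean]
    rw [axisProd, dirInt_prod]
    simp_rw [ih]

theorem contDiffOn_iterMean (hc : Convex ℝ D) (hu : UniqueDiffOn ℝ D) {f : Y × E n → ℝ}
    (hf : ContDiffOn ℝ ∞ f (D ×ˢ univ)) (m : ℕ) :
    ContDiffOn ℝ ∞ (iterMean (axisProd Y n) f m) (D ×ˢ univ) := by
  induction m with
  | zero => exact hf
  | succ m ih =>
    exact (stableUnder_prod D _).contDiffOn_dirInt (hc.prod convex_univ)
      (hu.prod uniqueDiffOn_univ) continuous_const ih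

theorem derivAlong_iterMean (hc : Convex ℝ D) (hu : UniqueDiffOn ℝ D) {f : Y × E n → ℝ}
    (hf : ContDiffOn ℝ ∞ f (D ×ˢ univ)) (v : Y × E n) (m : ℕ) :
    EqOn (derivAlong (D ×ˢ univ) v (iterMean (axisProd Y n) f m))
      (iterMean (axisProd Y n) (derivAlong (D ×ˢ univ) v f) m) (D ×ˢ univ) := by
  induction m with
  | zero => exact fun _ _ => rfl
  | succ m ih =>
    intro p hp
    have hS := stableUnder_prod D (axis n m)
    refine (hS.derivAlong_dirInt (hc.prod convex_univ)
      (hu.prod uniqueDiffOn_univ) continuous_const (contDiffOn_iterMean hc hu hf m) v hp).trans ?_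
    apply intervalIntegral.integral_congr
    intro r hr
    rw [uIcc_of_le zero_le_one] at hr
    simp only [one_smul]
    exact ih (hS p hp r hr)

end Product

/-! ### Existence and smoothness of the normalizing constant. -/

section Normalizer

variable {n : ℕ} {τ : ℝ}

theorem SmoothOnTorus.continuous_slice {F : Type*} [NormedAddCommGroup F] [NormedSpace ℝ F]
    {f : ℝ → E n → F} (hf : SmoothOnTorus τ f) {t : ℝ} (ht : t ∈ Icc 0 τ) :
    Continuous (f t) := by
  rw [← continuousOn_univ]
  exact hf.1.continuousOn.comp (f := fun x : E n => (t, x)) (by fun_prop) fun x _ => ⟨ht, mem_univ _⟩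

theorem SmoothOnTorus.exists_bound {F : Type*} [NormedAddCommGroup F] [NormedSpace ℝ F]
    {f : ℝ → E n → F} (hf : SmoothOnTorus τ f) :
    ∃ C, 0 ≤ C ∧ ∀ t ∈ Icc 0 τ, ∀ x, ‖f t x‖ ≤ C := by
  obtain ⟨C, hC⟩ := (isCompact_Icc.prod (isBounded_unitCube (n := n)).isCompact_closure
    ).exists_bound_of_continuousOn (hf.1.continuousOn.mono (prod_mono_right (subset_univ _)))
  refine ⟨max C 0, le_max_right _ _, fun t ht x => ?_⟩
  rw [← IsPeriodic.exists_mem_unitCube (hf.2 t ht) x]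
  exact (hC (t, _) ⟨ht, subset_closure (fract_mem_unitCube x)⟩).trans (le_max_left _ _)

/-- The parameter domain of the pairs `(δ², t)`. -/
def paramSet (s₀ τ : ℝ) : Set (ℝ × ℝ) := Icc 0 s₀ ×ˢ Icc 0 τ

theorem convex_paramSet (s₀ τ : ℝ) : Convex ℝ (paramSet s₀ τ) :=
  (convex_Icc _ _).prod (convex_Icc _ _)

theorem uniqueDiffOn_paramSet {s₀ τ : ℝ} (hs : 0 < s₀) (hτ : 0 < τ) :
    UniqueDiffOn ℝ (paramSet s₀ τ) :=
  (uniqueDiffOn_Icc hs).prod (uniqueDiffOn_Icc hτ)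

variable {π : ℝ → E n → ℝ} {s₀ M α : ℝ}

/-- This keeps `sπ + κ` above `1/4` whenever `κ ∈ (1/2, 3/2)`, away from the singularity of the
power. -/
theorem abs_mul_le_quarter (hπM : ∀ t ∈ Icc 0 τ, ∀ x, ‖π t x‖ ≤ M) (hM : s₀ * M ≤ 1 / 4)
    (hM0 : 0 ≤ M) {y : ℝ × ℝ} (hy : y ∈ paramSet s₀ τ) (x : E n) :
    |y.1 * π y.2 x| ≤ y.1 * M ∧ y.1 * M ≤ 1 / 4 := by
  constructor
  · rw [abs_mul, abs_of_nonneg hy.1.1]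
    exact mul_le_mul_of_nonneg_left (hπM _ hy.2 x) hy.1.1
  · exact (mul_le_mul_of_nonneg_right hy.1.2 hM0).trans hM

/-- The mean of `(s π + κ)^α` as a function of `((s, t), κ)`. -/
noncomputable def powerMean (π : ℝ → E n → ℝ) (α : ℝ) (p : (ℝ × ℝ) × ℝ) : ℝ :=
  iterMean (axis n) (fun x => (p.1.1 * π p.1.2 x + p.2) ^ α) n 0

theorem contDiffOn_base (hπ : SmoothOnTorus τ π) :
    ContDiffOn ℝ ∞ (fun q : ((ℝ × ℝ) × ℝ) × E n => q.1.1.1 * π q.1.1.2 q.2 + q.1.2)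
      ((paramSet s₀ τ ×ˢ Ioo (1 / 2 : ℝ) (3 / 2)) ×ˢ univ) := by
  have h : ContDiffOn ℝ ∞ (fun q : ((ℝ × ℝ) × ℝ) × E n => π q.1.1.2 q.2)
      ((paramSet s₀ τ ×ˢ Ioo (1 / 2 : ℝ) (3 / 2)) ×ˢ univ) :=
    hπ.1.comp (f := fun q : ((ℝ × ℝ) × ℝ) × E n => (q.1.1.2, q.2)) (by fun_prop)
      fun q hq => ⟨hq.1.1.2, mem_univ _⟩
  exact ((contDiff_fst.fst.fst).contDiffOn.mul h).add (contDiff_fst.snd).contDiffOn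

/-- These are the hypotheses of `contDiffOn_implicit`. Differentiation commutes with the mean, and
the `κ`-derivative of the integrand is `α(sπ + κ)^{α-1} > 0`. -/
theorem powerMean_spec (hs : 0 < s₀) (hτ : 0 < τ) (hα : 0 < α) (hπ : SmoothOnTorus τ π)
    (hπM : ∀ t ∈ Icc 0 τ, ∀ x, ‖π t x‖ ≤ M) (hM : s₀ * M ≤ 1 / 4) (hM0 : 0 ≤ M) :
    ContDiffOn ℝ ∞ (powerMean π α) (paramSet s₀ τ ×ˢ Ioo (1 / 2 : ℝ) (3 / 2)) ∧
    ∀ p ∈ paramSet s₀ τ ×ˢ Ioo (1 / 2 : ℝ) (3 / 2),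
      0 < derivAlong (paramSet s₀ τ ×ˢ Ioo (1 / 2 : ℝ) (3 / 2)) (0, 1) (powerMean π α) p := by
  set Q := paramSet s₀ τ ×ˢ Ioo (1 / 2 : ℝ) (3 / 2) with hQ
  have hQc : Convex ℝ Q := (convex_paramSet _ _).prod (convex_Ioo _ _)
  have hQu : UniqueDiffOn ℝ Q := (uniqueDiffOn_paramSet hs hτ).prod isOpen_Ioo.uniqueDiffOn
  set b : ((ℝ × ℝ) × ℝ) × E n → ℝ := fun q => q.1.1.1 * π q.1.1.2 q.2 + q.1.2 with hb
  have hbs : ContDiffOn ℝ ∞ b (Q ×ˢ univ) := contDiffOn_base hπ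
  have hbpos : ∀ q ∈ Q ×ˢ (univ : Set (E n)), 0 < b q := by
    intro q hq
    obtain ⟨h1, h2⟩ := abs_mul_le_quarter hπM hM hM0 hq.1.1 q.2
    have h3 := (abs_le.1 h1).1
    have h4 := hq.1.2.1
    simp only [hb]
    linarith
  set B : ((ℝ × ℝ) × ℝ) × E n → ℝ := fun q => b q ^ α with hB
  have hBs : ContDiffOn ℝ ∞ B (Q ×ˢ univ) :=
    hbs.rpow_const_of_ne fun q hq => (hbpos q hq).ne'
  have hI := contDiffOn_iterMean hQc hQu hBs n
  have hPM : powerMean π α = fun p => iterMean (axisProd ((ℝ × ℝ) × ℝ) n) B n (p, 0) := by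
    ext p
    rw [iterMean_prod]
    rfl
  constructor
  · rw [hPM]
    exact hI.comp (f := fun p : (ℝ × ℝ) × ℝ => (p, (0 : E n))) (by fun_prop)
      fun p hp => ⟨hp, mem_univ _⟩
  · intro p hp
    have hp' : (p, (0 : E n)) ∈ Q ×ˢ (univ : Set (E n)) := ⟨hp, mem_univ _⟩
    have hd : derivAlong Q (0, 1) (powerMean π α) p
        = derivAlong (Q ×ˢ univ) (((0, 1), 0) : ((ℝ × ℝ) × ℝ) × E n)
          (iterMean (axisProd ((ℝ × ℝ) × ℝ) n) B n) (p, 0) := by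
      have h1 := (hI.differentiableOn (by simp) _ hp').hasFDerivWithinAt
      have h2 : HasFDerivWithinAt (fun p : (ℝ × ℝ) × ℝ => (p, (0 : E n)))
          (ContinuousLinearMap.inl ℝ ((ℝ × ℝ) × ℝ) (E n)) Q p :=
        (hasFDerivAt_prodMk_left p 0).hasFDerivWithinAt
      have h3 := h1.comp p h2 fun p hp => mk_mem_prod hp (mem_univ (0 : E n))
      rw [derivAlong, hPM]
      change fderivWithin ℝ (iterMean (axisProd ((ℝ × ℝ) × ℝ) n) B n ∘ fun p => (p, (0 : E n)))
        Q p _ = _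
      rw [h3.fderivWithin (hQu p hp)]
      rfl
    rw [hd, derivAlong_iterMean hQc hQu hBs _ n hp', iterMean_prod]
    refine iterMean_pos ?_ (fun x => ?_) n 0
    · rw [← continuousOn_univ]
      exact (contDiffOn_derivAlong (hQu.prod uniqueDiffOn_univ) hBs _).continuousOn.comp
        (f := fun x : E n => (p, x)) (by fun_prop) fun x _ => ⟨hp, mem_univ _⟩
    · have hx : (p, x) ∈ Q ×ˢ (univ : Set (E n)) := ⟨hp, mem_univ _⟩
      have hl : HasDerivAt (fun r : ℝ => ((p.1, r), x)) (((0, 1), 0) : ((ℝ × ℝ) × ℝ) × E n) p.2 :=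
        ((hasDerivAt_const _ _).prodMk (hasDerivAt_id _)).prodMk (hasDerivAt_const _ _)
      have h1 : HasDerivAt (fun r : ℝ => B ((p.1, r), x))
          (derivAlong (Q ×ˢ univ) (((0, 1), 0) : ((ℝ × ℝ) × ℝ) × E n) B (p, x)) p.2 :=
        ((hBs.differentiableOn (by simp) _ hx).hasFDerivWithinAt.comp_hasDerivWithinAt
          (f := fun r : ℝ => ((p.1, r), x)) p.2
          (hl.hasDerivWithinAt (s := Ioo (1 / 2) (3 / 2)))
          fun r hr => ⟨⟨hp.1, hr⟩, mem_univ _⟩).hasDerivAt (isOpen_Ioo.mem_nhds hp.2)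
      have h2 : HasDerivAt (fun r : ℝ => B ((p.1, r), x))
          (1 * α * (p.1.1 * π p.1.2 x + p.2) ^ (α - 1)) p.2 :=
        ((hasDerivAt_id p.2).const_add (p.1.1 * π p.1.2 x)).rpow_const
          (Or.inl (hbpos _ hx).ne')
      rw [h1.unique h2]
      have h3 : 0 < p.1.1 * π p.1.2 x + p.2 := hbpos _ hx
      positivity

/-- The normalizing constant, as a smooth function of `(δ², t)`. -/
theorem exists_smooth_normalizer (hs : 0 < s₀) (hτ : 0 < τ) (hα : 0 < α)
    (hπ : SmoothOnTorus τ π) (hπM : ∀ t ∈ Icc 0 τ, ∀ x, ‖π t x‖ ≤ M) (hM : s₀ * M ≤ 1 / 4)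
    (hM0 : 0 ≤ M) :
    ∃ K : ℝ × ℝ → ℝ, ContDiffOn ℝ ∞ K (paramSet s₀ τ) ∧
      (∀ y ∈ paramSet s₀ τ, |K y - 1| ≤ y.1 * M) ∧
      ∀ y ∈ paramSet s₀ τ, powerMean π α (y, K y) = 1 := by
  obtain ⟨hH, hpos⟩ := powerMean_spec hs hτ hα hπ hπM hM hM0
  -- Since `|sπ| ≤ sM`, the base is at most 1 for `κ = 1 - sM` and at least 1 for `κ = 1 + sM`; the
  -- intermediate value theorem applies between them.
  have hex : ∀ y ∈ paramSet s₀ τ, ∃ κ, |κ - 1| ≤ y.1 * M ∧ powerMean π α (y, κ) = 1 := by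
    intro y hy
    have hq := fun x => abs_mul_le_quarter hπM hM hM0 hy x
    have hcont : ∀ κ ∈ Icc (1 - y.1 * M) (1 + y.1 * M),
        Continuous fun x => (y.1 * π y.2 x + κ) ^ α := by
      intro κ hκ
      have := hπ.continuous_slice hy.2
      exact Continuous.rpow_const (by fun_prop) fun x => Or.inr hα.le
    have hyM : 0 ≤ y.1 * M := mul_nonneg hy.1.1 hM0
    have hl : powerMean π α (y, 1 - y.1 * M) ≤ 1 := by
      have h := iterMean_mono (hcont (1 - y.1 * M) ⟨le_rfl, by linarith⟩)
        (continuous_const (y := (1 : ℝ))) (fun x => ?_) n 0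
      · rwa [iterMean_fun_const] at h
      · have h1 := abs_le.1 (hq x).1
        have h2 := (hq x).2
        exact Real.rpow_le_one (by linarith) (by linarith) hα.le
    have hr : 1 ≤ powerMean π α (y, 1 + y.1 * M) := by
      have h := iterMean_mono (continuous_const (y := (1 : ℝ)))
        (hcont (1 + y.1 * M) ⟨by linarith, le_rfl⟩) (fun x => ?_) n 0
      · rwa [iterMean_fun_const] at h
      · have h1 := abs_le.1 (hq x).1
        exact Real.one_le_rpow (by linarith) hα.le
    have hquarter := (hq 0).2
    have hc : ContinuousOn (fun κ => powerMean π α (y, κ)) (Icc (1 - y.1 * M) (1 + y.1 * M)) :=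
      hH.continuousOn.comp (f := fun κ : ℝ => (y, κ)) (by fun_prop) fun κ hκ =>
        ⟨hy, by linarith [hκ.1], by linarith [hκ.2]⟩
    obtain ⟨κ, hκ, h1⟩ := intermediate_value_Icc (by linarith) hc ⟨hl, hr⟩
    exact ⟨κ, abs_le.2 ⟨by linarith [hκ.1], by linarith [hκ.2]⟩, h1⟩
  -- No care is needed in the choice: strict monotonicity in `κ` makes the root unique in `(1/2,
  -- 3/2)`.
  choose! K hK1 hK2 using hex
  refine ⟨K, ?_, hK1, hK2⟩
  refine contDiffOn_implicit (uniqueDiffOn_paramSet hs hτ) hH hpos (fun y hy => ?_) hK2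
  have h1 := abs_le.1 (hK1 y hy)
  have h2 := (abs_mul_le_quarter hπM hM hM0 hy 0).2
  exact ⟨by linarith, by linarith⟩

end Normalizer

/-! ### Periodicity with parameters. -/

section PeriodicOn

variable {n : ℕ} {Y : Type} [NormedAddCommGroup Y] [NormedSpace ℝ Y] {D : Set Y}
  {F : Type*}

/-- `f (y, ·)` is a function on the torus for every `y ∈ D`. -/
def PeriodicOn (D : Set Y) (f : Y × E n → F) : Prop :=
  ∀ y ∈ D, IsPeriodic fun x => f (y, x)

theorem PeriodicOn.dirInt {f : Y × E n → ℝ} (hf : PeriodicOn D f) (g : ℝ → ℝ) (e : E n) :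
    PeriodicOn D (dirInt g ((0, e) : Y × E n) f) := by
  intro y hy
  simp_rw [dirInt_prod]
  exact (hf y hy).dirInt g e

theorem PeriodicOn.iterMean {f : Y × E n → ℝ} (hf : PeriodicOn D f) (m : ℕ) :
    PeriodicOn D (iterMean (axisProd Y n) f m) := by
  intro y hy
  simp_rw [iterMean_prod]
  exact (hf y hy).iterMean m

/-- Spatial translations preserve `D ×ˢ univ`, so they commute with the derivative within that set.
-/
theorem PeriodicOn.derivAlong [NormedAddCommGroup F] [NormedSpace ℝ F] {f : Y × E n → F}
    (hf : PeriodicOn D f) (v : Y × E n) : PeriodicOn D (derivAlong (D ×ˢ univ) v f) := by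
  intro y hy x i
  have hS : ((0, basisVec i) : Y × E n) +ᵥ (D ×ˢ (univ : Set (E n))) = D ×ˢ univ := by
    ext p
    simp [mem_vadd_set_iff_neg_vadd_mem]
  have h1 := fderivWithin_comp_add_right (𝕜 := ℝ) (f := f) (s := D ×ˢ (univ : Set (E n)))
    (x := (y, x)) ((0, basisVec i) : Y × E n)
  rw [hS] at h1
  have h2 : fderivWithin ℝ (fun p => f (p + ((0, basisVec i) : Y × E n))) (D ×ˢ univ) (y, x)
      = fderivWithin ℝ f (D ×ˢ univ) (y, x) := by
    refine fderivWithin_congr (fun p hp => ?_) ?_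
    · obtain ⟨z, w⟩ := p
      simpa using hf z hp.1 w i
    · simpa using hf y hy x i
  have h3 : (y, x + basisVec i) = (y, x) + ((0, basisVec i) : Y × E n) := by simp
  simp only [LowMach.derivAlong]
  rw [h3, ← h1, h2]

end PeriodicOn

/-! ### Fixing the parameter `s`: derivatives, and smallness near `s = 0`. -/

section Slices

variable {n : ℕ} {s₀ τ : ℝ} {F : Type*} [NormedAddCommGroup F] [NormedSpace ℝ F]

/-- The space-time-parameter domain of the variables `((δ², t), x)`. -/
def fullSet (n : ℕ) (s₀ τ : ℝ) : Set ((ℝ × ℝ) × E n) := paramSet s₀ τ ×ˢ univ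

theorem convex_fullSet : Convex ℝ (fullSet n s₀ τ) := (convex_paramSet _ _).prod convex_univ

theorem uniqueDiffOn_fullSet (hs : 0 < s₀) (hτ : 0 < τ) : UniqueDiffOn ℝ (fullSet n s₀ τ) :=
  (uniqueDiffOn_paramSet hs hτ).prod uniqueDiffOn_univ

/-- The time direction. -/
def timeDir (n : ℕ) : (ℝ × ℝ) × E n := ((0, 1), 0)

/-- The `i`-th space direction. -/
noncomputable def spaceDir (i : Fin n) : (ℝ × ℝ) × E n := (0, basisVec i)

theorem hasDerivWithinAt_time {f : (ℝ × ℝ) × E n → F} (hf : ContDiffOn ℝ ∞ f (fullSet n s₀ τ))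
    {s t : ℝ} (hs : s ∈ Icc 0 s₀) (ht : t ∈ Icc 0 τ) (x : E n) :
    HasDerivWithinAt (fun r => f ((s, r), x))
      (derivAlong (fullSet n s₀ τ) (timeDir n) f ((s, t), x)) (Icc 0 τ) t := by
  have hl : HasDerivAt (fun r : ℝ => ((s, r), x)) (timeDir n) t :=
    ((hasDerivAt_const _ _).prodMk (hasDerivAt_id _)).prodMk (hasDerivAt_const _ _)
  exact (hf.differentiableOn (by simp) ((s, t), x) ⟨⟨hs, ht⟩, mem_univ _⟩
    ).hasFDerivWithinAt.comp_hasDerivWithinAt (f := fun r : ℝ => ((s, r), x)) t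
    hl.hasDerivWithinAt fun r hr => ⟨⟨hs, hr⟩, mem_univ _⟩

theorem dt_slice {f : (ℝ × ℝ) × E n → ℝ} (hf : ContDiffOn ℝ ∞ f (fullSet n s₀ τ))
    (hτ : 0 < τ) {s t : ℝ} (hs : s ∈ Icc 0 s₀) (ht : t ∈ Icc 0 τ) (x : E n) :
    dt τ (fun t x => f ((s, t), x)) t x
      = derivAlong (fullSet n s₀ τ) (timeDir n) f ((s, t), x) :=
  (hasDerivWithinAt_time hf hs ht x).derivWithin (uniqueDiffOn_Icc hτ t ht)

theorem dx_slice {f : (ℝ × ℝ) × E n → ℝ} (hf : ContDiffOn ℝ ∞ f (fullSet n s₀ τ))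
    {s t : ℝ} (hs : s ∈ Icc 0 s₀) (ht : t ∈ Icc 0 τ) (i : Fin n) (x : E n) :
    dx i (fun x => f ((s, t), x)) x
      = derivAlong (fullSet n s₀ τ) (spaceDir i) f ((s, t), x) := by
  have h1 := (hf.differentiableOn (by simp) ((s, t), x) ⟨⟨hs, ht⟩, mem_univ _⟩).hasFDerivWithinAt
  have h2 : HasFDerivWithinAt (fun x : E n => ((s, t), x))
      (ContinuousLinearMap.inr ℝ (ℝ × ℝ) (E n)) univ x :=
    (hasFDerivAt_prodMk_right (s, t) x).hasFDerivWithinAt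
  have h3 := h1.comp x h2 fun z _ => ⟨⟨hs, ht⟩, mem_univ z⟩
  rw [hasFDerivWithinAt_univ] at h3
  change fderiv ℝ (f ∘ fun x : E n => ((s, t), x)) x _ = _
  rw [h3.fderiv]
  rfl

theorem smoothOnTorus_slice {f : (ℝ × ℝ) × E n → F} (hf : ContDiffOn ℝ ∞ f (fullSet n s₀ τ))
    (hp : PeriodicOn (paramSet s₀ τ) f) {s : ℝ} (hs : s ∈ Icc 0 s₀) :
    SmoothOnTorus τ fun t x => f ((s, t), x) := by
  constructor
  · exact hf.comp (f := fun p : ℝ × E n => ((s, p.1), p.2)) (by fun_prop)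
      fun p hp => ⟨⟨hs, hp.1⟩, mem_univ _⟩
  · exact fun t ht x i => hp (s, t) ⟨hs, ht⟩ x i

/-- Used in two ways: the constant mean of `ρ` makes `∂ₜρ` mean-free, and functions constant in time
at `s = 0` have vanishing time derivative there. -/
theorem derivAlong_time_eq_zero {f : (ℝ × ℝ) × E n → F}
    (hf : ContDiffOn ℝ ∞ f (fullSet n s₀ τ)) (hτ : 0 < τ) {s c : ℝ} {z : F} (hs : s ∈ Icc 0 s₀)
    (hc : c ∈ Icc 0 τ) {x : E n} (h : ∀ t ∈ Icc 0 τ, f ((s, t), x) = z) :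
    derivAlong (fullSet n s₀ τ) (timeDir n) f ((s, c), x) = 0 := by
  have h1 := hasDerivWithinAt_time hf hs hc x
  have h2 : HasDerivWithinAt (fun r => f ((s, r), x)) 0 (Icc 0 τ) c :=
    (hasDerivWithinAt_const c (Icc 0 τ) z).congr h (h c hc)
  exact (uniqueDiffOn_Icc hτ c hc).eq_deriv _ h1 h2

/-- Compactness of `[0, τ]` times the closed cube makes continuity at `s = 0` uniform; periodicity
extends the bound to all `x`. -/
theorem exists_uniformly_small {F : Type*} [NormedAddCommGroup F] {f : (ℝ × ℝ) × E n → F}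
    (hf : ContinuousOn f (fullSet n s₀ τ)) (hp : PeriodicOn (paramSet s₀ τ) f) (hs₀ : 0 < s₀)
    (h0 : ∀ t ∈ Icc 0 τ, ∀ x, f ((0, t), x) = 0) {η : ℝ} (hη : 0 < η) :
    ∃ s₁ > 0, s₁ ≤ s₀ ∧ ∀ s ∈ Icc 0 s₁, ∀ t ∈ Icc 0 τ, ∀ x, ‖f ((s, t), x)‖ < η := by
  have key : ∀ᶠ s in 𝓝 (0 : ℝ), ∀ q ∈ Icc 0 τ ×ˢ closure (unitCube n),
      s ∈ Icc 0 s₀ → q.1 ∈ Icc 0 τ → ‖f ((s, q.1), q.2)‖ < η := by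
    apply (isCompact_Icc.prod
      isBounded_unitCube.isCompact_closure).eventually_forall_of_forall_eventually
    intro q hq
    have hc : ContinuousOn (fun p : ℝ × ℝ × E n => f ((p.1, p.2.1), p.2.2))
        (Icc 0 s₀ ×ˢ Icc 0 τ ×ˢ univ) :=
      hf.comp (by fun_prop) fun p hp => ⟨⟨hp.1, hp.2.1⟩, mem_univ _⟩
    have h1 := (hc (0, q) ⟨⟨le_rfl, hs₀.le⟩, hq.1, mem_univ _⟩).norm.tendsto
    rw [h0 q.1 hq.1 q.2, norm_zero] at h1
    have h2 := h1.eventually (gt_mem_nhds hη)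
    rw [eventually_nhdsWithin_iff] at h2
    filter_upwards [h2] with p hp h3 h4 using hp ⟨h3, h4, mem_univ _⟩
  obtain ⟨r, hr, hb⟩ := Metric.eventually_nhds_iff_ball.1 key
  refine ⟨min s₀ (r / 2), by positivity, min_le_left _ _, fun s hs t ht x => ?_⟩
  have hs1 := hs.2.trans (min_le_left _ _)
  have hs2 := hs.2.trans (min_le_right _ _)
  rw [← (hp (s, t) ⟨⟨hs.1, hs1⟩, ht⟩).exists_mem_unitCube x]
  refine hb s ?_ (t, _) ⟨ht, subset_closure (fract_mem_unitCube x)⟩ ⟨hs.1, hs1⟩ ht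
  rw [Metric.mem_ball, Real.dist_eq, sub_zero, abs_of_nonneg hs.1]
  linarith

end Slices

/-! ### Solving the two divergence equations by segment integrals. -/

section Correction

variable {n : ℕ} {s₀ τ : ℝ} {ρ : (ℝ × ℝ) × E n → ℝ}

/-- A momentum correction `w` with `div w = -∂ₜρ`, together with a diagonal stress `σ` that
balances `∂ₜw`. Both vanish together with `ρ - 1` at parameter `0`. -/
theorem exists_correction (hs₀ : 0 < s₀) (hτ : 0 < τ) (hρ : ContDiffOn ℝ ∞ ρ (fullSet n s₀ τ))
    (hper : PeriodicOn (paramSet s₀ τ) ρ)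
    (hmean : ∀ p ∈ fullSet n s₀ τ, iterMean (axisProd (ℝ × ℝ) n) ρ n p = 1)
    (hρ0 : ∀ t ∈ Icc 0 τ, ∀ x, ρ ((0, t), x) = 1) :
    ∃ w σ : Fin n → (ℝ × ℝ) × E n → ℝ,
      (∀ i, ContDiffOn ℝ ∞ (w i) (fullSet n s₀ τ)) ∧
      (∀ i, ContDiffOn ℝ ∞ (σ i) (fullSet n s₀ τ)) ∧
      (∀ i, PeriodicOn (paramSet s₀ τ) (w i)) ∧
      (∀ i, PeriodicOn (paramSet s₀ τ) (σ i)) ∧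
      (∀ i, ∀ t ∈ Icc 0 τ, ∀ x, w i ((0, t), x) = 0) ∧
      (∀ i, ∀ t ∈ Icc 0 τ, ∀ x, σ i ((0, t), x) = 0) ∧
      (∀ s ∈ Icc 0 s₀, ∀ t ∈ Icc 0 τ, ∀ x,
        dt τ (fun t x => ρ ((s, t), x)) t x + ∑ i, dx i (fun x => w i ((s, t), x)) x = 0) ∧
      (∀ i, ∀ s ∈ Icc 0 s₀, ∀ t ∈ Icc 0 τ, ∀ x,
        dt τ (fun t x => w i ((s, t), x)) t x + dx i (fun x => σ i ((s, t), x)) x = 0) := by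
  set S := fullSet n s₀ τ with hS
  have hu : UniqueDiffOn ℝ S := uniqueDiffOn_fullSet hs₀ hτ
  have hcv : Convex ℝ S := convex_fullSet
  have hst : ∀ i : Fin n, StableUnder (spaceDir i) S := fun i => stableUnder_prod _ _
  have h00 : (0 : ℝ) ∈ Icc 0 s₀ := ⟨le_rfl, hs₀.le⟩
  -- `N 0 = ∂ₜρ`, and `N n` is its full average, which vanishes because the mean of `ρ` is constant
  -- in time.
  set N : ℕ → (ℝ × ℝ) × E n → ℝ :=
    iterMean (axisProd (ℝ × ℝ) n) (derivAlong S (timeDir n) ρ) with hN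
  have hNs : ∀ m, ContDiffOn ℝ ∞ (N m) S := fun m =>
    contDiffOn_iterMean (convex_paramSet _ _) (uniqueDiffOn_paramSet hs₀ hτ)
      (contDiffOn_derivAlong hu hρ _) m
  have hNp : ∀ m, PeriodicOn (paramSet s₀ τ) (N m) := fun m => (hper.derivAlong _).iterMean m
  have hNn : ∀ p ∈ S, N n p = 0 := by
    intro p hp
    have h1 := derivAlong_iterMean (convex_paramSet _ _) (uniqueDiffOn_paramSet hs₀ hτ) hρ
      (timeDir n) n hp
    refine h1.symm.trans ?_
    exact derivAlong_time_eq_zero (s := p.1.1) (c := p.1.2) (x := p.2) (z := 1)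
      (contDiffOn_iterMean (convex_paramSet _ _) (uniqueDiffOn_paramSet hs₀ hτ) hρ n) hτ
      hp.1.1 hp.1.2 fun t ht => hmean _ ⟨⟨hp.1.1, ht⟩, mem_univ _⟩
  have hN0 : ∀ m, ∀ t ∈ Icc 0 τ, ∀ x, N m ((0, t), x) = 0 := by
    intro m t ht x
    rw [hN, iterMean_prod]
    have : (fun x => derivAlong S (timeDir n) ρ ((0, t), x)) = fun _ => 0 := by
      ext x
      exact derivAlong_time_eq_zero hρ hτ h00 ht fun r hr => hρ0 r hr x
    rw [this, iterMean_fun_const]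
  set M : ℕ → (ℝ × ℝ) × E n → ℝ := fun m => derivAlong S (timeDir n) (N m) with hM
  have hMs : ∀ m, ContDiffOn ℝ ∞ (M m) S := fun m => contDiffOn_derivAlong hu (hNs m) _
  have hMp : ∀ m, PeriodicOn (paramSet s₀ τ) (M m) := fun m => (hNp m).derivAlong _
  have hM0 : ∀ m, ∀ t ∈ Icc 0 τ, ∀ x, M m ((0, t), x) = 0 := fun m t ht x =>
    derivAlong_time_eq_zero (hNs m) hτ h00 ht fun r hr => hN0 m r hr x
  -- Integration by parts dictates the kernels. From `g₁' = -1`, `g₁ 0 = 1/2`, `g₁ 1 = -1/2` and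
  -- periodicity, the `i`-th derivative of the integral of `N i` is `N (i + 1) - N i`. The kernel
  -- `g₂` is the primitive of `g₁` vanishing at both ends, so only `-∂ₜwᵢ` remains for `σᵢ`.
  set g₁ : ℝ → ℝ := fun r => 1 / 2 - r with hg₁
  set g₂ : ℝ → ℝ := fun r => (r - r ^ 2) / 2 with hg₂
  have hg₁c : Continuous g₁ := by fun_prop
  have hg₂c : Continuous g₂ := by fun_prop
  have hd₁ : ∀ r, HasDerivAt g₁ (-1) r := fun r => by
    simpa using (hasDerivAt_id r).const_sub (1 / 2)
  have hd₂ : ∀ r, HasDerivAt g₂ (g₁ r) r := fun r => by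
    have := ((hasDerivAt_id r).sub (hasDerivAt_pow 2 r)).div_const 2
    refine this.congr_deriv ?_
    simp only [hg₁]
    norm_num
    ring
  have hws : ∀ i : Fin n, ContDiffOn ℝ ∞ (dirInt g₁ (spaceDir i) (N i)) S := fun i =>
    (hst i).contDiffOn_dirInt hcv hu hg₁c (hNs i)
  have hσs : ∀ i : Fin n, ContDiffOn ℝ ∞ (dirInt g₂ (spaceDir i) (M i)) S := fun i =>
    (hst i).contDiffOn_dirInt hcv hu hg₂c (hMs i)
  have hzero : ∀ (g : ℝ → ℝ) (e : E n) (f : (ℝ × ℝ) × E n → ℝ),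
      (∀ t ∈ Icc 0 τ, ∀ x, f ((0, t), x) = 0) → ∀ t ∈ Icc 0 τ, ∀ x,
      dirInt g ((0, e) : (ℝ × ℝ) × E n) f ((0, t), x) = 0 := by
    intro g e f hf t ht x
    rw [dirInt_prod]
    simp [dirInt, hf t ht]
  refine ⟨fun i => dirInt g₁ (spaceDir i) (N i), fun i => dirInt g₂ (spaceDir i) (M i),
    hws, hσs, fun i => (hNp i).dirInt _ _, fun i => (hMp i).dirInt _ _,
    fun i => hzero _ _ _ (hN0 i), fun i => hzero _ _ _ (hM0 i), ?_, ?_⟩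
  · intro s hs t ht x
    have hp : ((s, t), x) ∈ S := ⟨⟨hs, ht⟩, mem_univ _⟩
    have hi : ∀ i : Fin n, dx i (fun x => dirInt g₁ (spaceDir i) (N i) ((s, t), x)) x
        = N (i + 1) ((s, t), x) - N i ((s, t), x) := by
      intro i
      have h1 : N i (((s, t), x) + spaceDir i) = N i ((s, t), x) := by
        have := hNp i (s, t) ⟨hs, ht⟩ x i
        simpa [spaceDir] using this
      have h2 : dirInt (fun _ => (-1 : ℝ)) (spaceDir i) (N i) ((s, t), x)
          = - N (i + 1) ((s, t), x) := by
        simp only [hN, iterMean, dirInt, axisProd, axis_fin, spaceDir, smul_eq_mul, neg_mul,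
          one_mul, intervalIntegral.integral_neg]
      rw [dx_slice (hws i) hs ht, (hst i).derivAlong_dirInt_self hcv hu hd₁ continuous_const
        (hNs i) hp, h1, h2]
      simp only [hg₁]
      ring
    -- The divergence telescopes to `N n - N 0 = -∂ₜρ`.
    rw [dt_slice hρ hτ hs ht, Finset.sum_congr rfl fun i _ => hi i,
      Finset.sum_range (f := fun i => N (i + 1) ((s, t), x) - N i ((s, t), x)) |>.symm,
      Finset.sum_range_sub (fun i => N i ((s, t), x)), hNn _ hp]
    simp [hN, hS, iterMean]
  · intro i s hs t ht x
    have hp : ((s, t), x) ∈ S := ⟨⟨hs, ht⟩, mem_univ _⟩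
    rw [dt_slice (hws i) hτ hs ht, dx_slice (hσs i) hs ht,
      (hst i).derivAlong_dirInt hcv hu hg₁c (hNs i) _ hp,
      (hst i).derivAlong_dirInt_self hcv hu hd₂ hg₁c (hMs i) hp]
    simp [hg₂, hM]

end Correction

/-! ### Algebra of smooth periodic fields, and matrix estimates. -/

section SmoothOnTorus

variable {n : ℕ} {τ : ℝ} {F G : Type*} [NormedAddCommGroup F] [NormedSpace ℝ F]
  [NormedAddCommGroup G] [NormedSpace ℝ G]

theorem SmoothOnTorus.clm_comp {f : ℝ → E n → F} (hf : SmoothOnTorus τ f) (L : F →L[ℝ] G) :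
    SmoothOnTorus τ fun t x => L (f t x) :=
  ⟨L.contDiff.comp_contDiffOn hf.1, fun t ht x i => congrArg L (hf.2 t ht x i)⟩

theorem SmoothOnTorus.add {f g : ℝ → E n → F} (hf : SmoothOnTorus τ f)
    (hg : SmoothOnTorus τ g) : SmoothOnTorus τ fun t x => f t x + g t x :=
  ⟨hf.1.add hg.1, fun t ht x i => congrArg₂ _ (hf.2 t ht x i) (hg.2 t ht x i)⟩

theorem SmoothOnTorus.sub {f g : ℝ → E n → F} (hf : SmoothOnTorus τ f)
    (hg : SmoothOnTorus τ g) : SmoothOnTorus τ fun t x => f t x - g t x :=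
  ⟨hf.1.sub hg.1, fun t ht x i => congrArg₂ _ (hf.2 t ht x i) (hg.2 t ht x i)⟩

theorem SmoothOnTorus.smul {f : ℝ → E n → ℝ} {g : ℝ → E n → F} (hf : SmoothOnTorus τ f)
    (hg : SmoothOnTorus τ g) : SmoothOnTorus τ fun t x => f t x • g t x :=
  ⟨hf.1.smul hg.1, fun t ht x i => congrArg₂ _ (hf.2 t ht x i) (hg.2 t ht x i)⟩

theorem SmoothOnTorus.mul {f g : ℝ → E n → ℝ} (hf : SmoothOnTorus τ f)
    (hg : SmoothOnTorus τ g) : SmoothOnTorus τ fun t x => f t x * g t x :=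
  hf.smul hg

theorem SmoothOnTorus.inv {f : ℝ → E n → ℝ} (hf : SmoothOnTorus τ f)
    (h : ∀ t ∈ Icc 0 τ, ∀ x, 0 < f t x) : SmoothOnTorus τ fun t x => (f t x)⁻¹ :=
  ⟨hf.1.inv fun p hp => (h p.1 hp.1 p.2).ne', fun t ht x i => congrArg _ (hf.2 t ht x i)⟩

theorem smoothOnTorus_const (c : F) : SmoothOnTorus τ fun _ (_ : E n) => c :=
  ⟨contDiffOn_const, fun _ _ _ _ => rfl⟩

theorem SmoothOnTorus.sum {ι : Type*} {s : Finset ι} {f : ι → ℝ → E n → F}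
    (hf : ∀ i ∈ s, SmoothOnTorus τ (f i)) : SmoothOnTorus τ fun t x => ∑ i ∈ s, f i t x :=
  ⟨ContDiffOn.sum fun i hi => (hf i hi).1,
    fun t ht x k => Finset.sum_congr rfl fun i hi => (hf i hi).2 t ht x k⟩

theorem SmoothOnTorus.differentiableAt {f : ℝ → E n → F} (hf : SmoothOnTorus τ f) {t : ℝ}
    (ht : t ∈ Icc 0 τ) (x : E n) : DifferentiableAt ℝ (f t) x := by
  rw [← differentiableWithinAt_univ]
  exact (hf.1.differentiableOn (by simp) (t, x) ⟨ht, mem_univ _⟩).comp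
    (f := fun x : E n => (t, x)) x (by fun_prop) fun z _ => ⟨ht, mem_univ _⟩

theorem SmoothOnTorus.differentiableWithinAt {f : ℝ → E n → F} (hf : SmoothOnTorus τ f) {t : ℝ}
    (ht : t ∈ Icc 0 τ) (x : E n) : DifferentiableWithinAt ℝ (fun s => f s x) (Icc 0 τ) t :=
  (hf.1.differentiableOn (by simp) (t, x) ⟨ht, mem_univ _⟩).comp
    (f := fun s : ℝ => (s, x)) t (by fun_prop) fun z hz => ⟨hz, mem_univ _⟩

theorem dt_add {f g : ℝ → E n → ℝ} (hf : SmoothOnTorus τ f) (hg : SmoothOnTorus τ g) {t : ℝ}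
    (ht : t ∈ Icc 0 τ) (x : E n) :
    dt τ (fun t x => f t x + g t x) t x = dt τ f t x + dt τ g t x :=
  derivWithin_fun_add (hf.differentiableWithinAt ht x) (hg.differentiableWithinAt ht x)

theorem dt_congr {f g : ℝ → E n → ℝ} (h : ∀ t ∈ Icc 0 τ, ∀ x, f t x = g t x) {t : ℝ}
    (ht : t ∈ Icc 0 τ) (x : E n) : dt τ f t x = dt τ g t x :=
  derivWithin_congr (fun s hs => h s hs x) (h t ht x)

theorem dx_add {f g : E n → ℝ} {x : E n} (hf : DifferentiableAt ℝ f x)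
    (hg : DifferentiableAt ℝ g x) (i : Fin n) :
    dx i (fun x => f x + g x) x = dx i f x + dx i g x := by
  simp [dx, fderiv_fun_add hf hg]

theorem dx_mul {f g : E n → ℝ} {x : E n} (hf : DifferentiableAt ℝ f x)
    (hg : DifferentiableAt ℝ g x) (i : Fin n) :
    dx i (fun x => f x * g x) x = f x * dx i g x + g x * dx i f x := by
  simp [dx, fderiv_fun_mul hf hg]

theorem dx_add_const (f : E n → ℝ) (c : ℝ) (i : Fin n) (x : E n) :
    dx i (fun x => f x + c) x = dx i f x := by
  simp [dx]

theorem SmoothOnTorus.coord {u : ℝ → E n → E n} (hu : SmoothOnTorus τ u) (i : Fin n) :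
    SmoothOnTorus τ fun t x => u t x i :=
  hu.clm_comp (EuclideanSpace.proj i : E n →L[ℝ] ℝ)

/-- The `(i, j)` entry as a continuous linear functional. -/
noncomputable def entryCLM (i j : Fin n) : Matrix (Fin n) (Fin n) ℝ →L[ℝ] ℝ :=
  LinearMap.toContinuousLinearMap (Matrix.entryLinearMap ℝ ℝ i j)

theorem SmoothOnTorus.entry {R : ℝ → E n → Matrix (Fin n) (Fin n) ℝ} (hR : SmoothOnTorus τ R)
    (i j : Fin n) : SmoothOnTorus τ fun t x => R t x i j :=
  hR.clm_comp (entryCLM i j)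

theorem matrix_eq_sum_smul_single (A : Matrix (Fin n) (Fin n) ℝ) :
    A = ∑ i, ∑ j, A i j • Matrix.single i j (1 : ℝ) := by
  conv_lhs => rw [Matrix.matrix_eq_sum_single A]
  simp [Matrix.smul_single]

theorem smoothOnTorus_matrix {R : ℝ → E n → Matrix (Fin n) (Fin n) ℝ}
    (h : ∀ i j, SmoothOnTorus τ fun t x => R t x i j) : SmoothOnTorus τ R := by
  have h1 : R = fun t x => ∑ i, ∑ j, R t x i j • Matrix.single i j (1 : ℝ) := by
    ext1 t
    ext1 x
    exact matrix_eq_sum_smul_single _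
  rw [h1]
  exact SmoothOnTorus.sum fun i _ => SmoothOnTorus.sum fun j _ =>
    (h i j).smul (smoothOnTorus_const _)

theorem norm_matrix_le {A : Matrix (Fin n) (Fin n) ℝ} {η : ℝ} (h : ∀ i j, |A i j| ≤ η) :
    ‖A‖ ≤ η * ∑ i : Fin n, ∑ j : Fin n, ‖Matrix.single i j (1 : ℝ)‖ := by
  conv_lhs => rw [matrix_eq_sum_smul_single A]
  rw [Finset.mul_sum]
  refine norm_sum_le_of_le _ fun i _ => ?_
  rw [Finset.mul_sum]
  refine norm_sum_le_of_le _ fun j _ => ?_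
  rw [norm_smul]
  exact mul_le_mul_of_nonneg_right (h i j) (norm_nonneg _)

/-- A small symmetric perturbation of a multiple of the identity is positive definite. -/
theorem posDef_add_smul_one {Z : Matrix (Fin n) (Fin n) ℝ} {c η : ℝ} (hZ : Z.IsSymm)
    (h : ∀ i j, |Z i j| ≤ η) (hη : n * η < c) :
    (Z + c • (1 : Matrix (Fin n) (Fin n) ℝ)).PosDef := by
  refine Matrix.PosDef.of_dotProduct_mulVec_pos ?_ fun x hx => ?_
  · rw [Matrix.IsHermitian, Matrix.conjTranspose_eq_transpose_of_trivial]
    exact hZ.add (by simp [Matrix.IsSymm])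
  · have hpos : 0 < ∑ i, x i ^ 2 := by
      obtain ⟨i, hi⟩ := Function.ne_iff.1 hx
      exact Finset.sum_pos' (fun i _ => sq_nonneg _) ⟨i, Finset.mem_univ _, by
        have : x i ≠ 0 := hi
        positivity⟩
    have h1 : star x ⬝ᵥ (Z + c • (1 : Matrix (Fin n) (Fin n) ℝ)).mulVec x
        = ∑ i, ∑ j, Z i j * x i * x j + c * ∑ i, x i ^ 2 := by
      rw [Matrix.add_mulVec, dotProduct_add, Matrix.smul_mulVec, Matrix.one_mulVec,
        dotProduct_smul]
      simp only [dotProduct, Matrix.mulVec, Finset.mul_sum, star_trivial, smul_eq_mul]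
      congr 1
      · refine Finset.sum_congr rfl fun i _ => Finset.sum_congr rfl fun j _ => by ring
      · exact Finset.sum_congr rfl fun i _ => by ring
    -- By `|xᵢxⱼ| ≤ (xᵢ² + xⱼ²)/2`, summing over `i, j` costs `nη|x|²`, which is less than `c|x|²`.
    have h2 : ∀ i j, -(η * (x i ^ 2 / 2 + x j ^ 2 / 2)) ≤ Z i j * x i * x j := by
      intro i j
      have h3 : |Z i j * x i * x j| ≤ η * (x i ^ 2 / 2 + x j ^ 2 / 2) := by
        rw [mul_assoc, abs_mul]
        refine mul_le_mul (h i j) ?_ (abs_nonneg _) ((abs_nonneg _).trans (h i j))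
        rw [abs_le]
        constructor <;> nlinarith [sq_nonneg (x i - x j), sq_nonneg (x i + x j)]
      exact (abs_le.1 h3).1
    have h4 : ∑ i, ∑ j, -(η * (x i ^ 2 / 2 + x j ^ 2 / 2)) = -(n * η * ∑ i, x i ^ 2) := by
      simp only [Finset.sum_neg_distrib, ← Finset.mul_sum, Finset.sum_add_distrib,
        Finset.sum_const, Finset.card_univ, Fintype.card_fin, nsmul_eq_mul, ← Finset.sum_div]
      ring
    have h5 := Finset.sum_le_sum fun i (_ : i ∈ Finset.univ) =>
      Finset.sum_le_sum fun j (_ : j ∈ Finset.univ) => h2 i j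
    rw [h4] at h5
    rw [h1]
    nlinarith

end SmoothOnTorus

/-! ### From the corrections to a compressible subsolution. -/

section Assembly

variable {n : ℕ} {τ ε γ δ c : ℝ} {u : ℝ → E n → E n} {π : ℝ → E n → ℝ}
  {R : ℝ → E n → Matrix (Fin n) (Fin n) ℝ} {ρ : ℝ → E n → ℝ} {K : ℝ → ℝ}
  {w σ : Fin n → ℝ → E n → ℝ}

/-- The vector field with components `w i`. -/
noncomputable def ofComponents (w : Fin n → ℝ → E n → ℝ) (t : ℝ) (x : E n) : E n :=
  ∑ i, w i t x • basisVec i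

theorem ofComponents_apply (t : ℝ) (x : E n) (i : Fin n) :
    ofComponents w t x i = w i t x := by
  simp [ofComponents, basisVec, Pi.single_apply]

theorem norm_ofComponents_le {η : ℝ} {t : ℝ} {x : E n} (h : ∀ i, |w i t x| ≤ η) :
    ‖ofComponents w t x‖ ≤ n * η := by
  refine (norm_sum_le_of_le (f := fun i => w i t x • (basisVec i : E n)) (n := fun _ => η)
    Finset.univ fun i _ => ?_).trans ?_
  · rw [norm_smul]
    simpa [basisVec] using h i
  · simp

/-- The difference of the incompressible and the compressible convective terms, plus the
diagonal stress. -/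
noncomputable def stressDefect (u : ℝ → E n → E n) (ρ : ℝ → E n → ℝ)
    (w σ : Fin n → ℝ → E n → ℝ) (t : ℝ) (x : E n) : Matrix (Fin n) (Fin n) ℝ :=
  Matrix.of fun i j => u t x i * u t x j
    - (ρ t x)⁻¹ * ((u t x i + w i t x) * (u t x j + w j t x)) + if i = j then σ i t x else 0

theorem stressDefect_isSymm (t : ℝ) (x : E n) : (stressDefect u ρ w σ t x).IsSymm := by
  refine Matrix.IsSymm.ext fun i j => ?_
  simp only [stressDefect, Matrix.of_apply]
  by_cases h : i = j
  · rw [h]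
  · rw [if_neg h, if_neg (Ne.symm h)]
    ring

theorem smoothOnTorus_stressDefect (hu : SmoothOnTorus τ u) (hρ : SmoothOnTorus τ ρ)
    (hpos : ∀ t ∈ Icc 0 τ, ∀ x, 0 < ρ t x) (hw : ∀ i, SmoothOnTorus τ (w i))
    (hσ : ∀ i, SmoothOnTorus τ (σ i)) : SmoothOnTorus τ (stressDefect u ρ w σ) := by
  refine smoothOnTorus_matrix fun i j => ?_
  simp only [stressDefect, Matrix.of_apply]
  refine (((hu.coord i).mul (hu.coord j)).sub ((hρ.inv hpos).mul
    (((hu.coord i).add (hw i)).mul ((hu.coord j).add (hw j))))).add ?_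
  split_ifs
  · exact hσ i
  · exact smoothOnTorus_const 0

theorem smoothOnTorus_velocity (hu : SmoothOnTorus τ u) (hρ : SmoothOnTorus τ ρ)
    (hpos : ∀ t ∈ Icc 0 τ, ∀ x, 0 < ρ t x) (hw : ∀ i, SmoothOnTorus τ (w i)) :
    SmoothOnTorus τ fun t x => (ρ t x)⁻¹ • (u t x + ofComponents w t x) :=
  (hρ.inv hpos).smul (hu.add (SmoothOnTorus.sum fun i _ => (hw i).smul (smoothOnTorus_const _)))

/-- The momentum is `ρv = u + w`. The stress cancels the quadratic terms in `u + w` and restores `u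
⊗ u`; the remaining `∂ₜw` is balanced by `diag σ`, and `c Id` has zero divergence. -/
theorem isCompressibleSubsolution_of_correction (hsub : IsIncompressibleSubsolution τ ε u π R)
    (hε : 0 < ε) (hδ : 0 < δ) (hρ : SmoothOnTorus τ ρ)
    (hpos : ∀ t ∈ Icc 0 τ, ∀ x, 0 < ρ t x)
    (hpress : ∀ t ∈ Icc 0 τ, ∀ x, ρ t x ^ γ = δ ^ 2 * π t x + K t)
    (hw : ∀ i, SmoothOnTorus τ (w i)) (hσ : ∀ i, SmoothOnTorus τ (σ i))
    (hdiv : ∀ t ∈ Icc 0 τ, ∀ x, dt τ ρ t x + ∑ i, dx i (w i t) x = 0)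
    (hbal : ∀ i, ∀ t ∈ Icc 0 τ, ∀ x, dt τ (w i) t x + dx i (σ i t) x = 0)
    (hZ : ∀ t ∈ Icc 0 τ, ∀ x,
      (stressDefect u ρ w σ t x + c • (1 : Matrix (Fin n) (Fin n) ℝ)).PosDef) :
    IsCompressibleSubsolution τ γ δ ρ (fun t x => (ρ t x)⁻¹ • (u t x + ofComponents w t x))
      (fun t x => R t x
        + (stressDefect u ρ w σ t x + c • (1 : Matrix (Fin n) (Fin n) ℝ))) := by
  have hu := hsub.smooth_u
  have hZs := smoothOnTorus_stressDefect hu hρ hpos hw hσ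
  have hRt := hZs.add (smoothOnTorus_const (τ := τ) (n := n)
    (c • (1 : Matrix (Fin n) (Fin n) ℝ)))
  have hv := smoothOnTorus_velocity hu hρ hpos hw
  have hm : ∀ t ∈ Icc 0 τ, ∀ (x : E n) (i : Fin n),
      ρ t x * ((ρ t x)⁻¹ • (u t x + ofComponents w t x)) i = u t x i + w i t x := by
    intro t ht x i
    have := (hpos t ht x).ne'
    rw [PiLp.smul_apply, PiLp.add_apply, ofComponents_apply, smul_eq_mul]
    field_simp
  have hui : ∀ i t, t ∈ Icc 0 τ → ∀ x, DifferentiableAt ℝ (fun y => u t y i) x :=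
    fun i t ht x => (hu.coord i).differentiableAt ht x
  refine ⟨hρ, hv, hsub.smooth_R.add hRt, hpos, fun t ht x => ?_, fun t ht x => ?_,
    fun t ht x i => ?_⟩
  · have h1 : (R t x).PosDef := by
      have h2 := (hsub.pos_R t ht x).add
        ((Matrix.PosDef.one (n := Fin n) (R := ℝ)).smul (show 0 < ε / 4 by positivity))
      simpa using h2
    exact h1.add (hZ t ht x)
  · have h1 : ∀ j, dx j (fun y => ρ t y * ((ρ t y)⁻¹ • (u t y + ofComponents w t y)) j) x
        = dx j (fun y => u t y j) x + dx j (w j t) x := by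
      intro j
      simp only [hm t ht]
      exact dx_add (hui j t ht x) ((hw j).differentiableAt ht x) j
    rw [Finset.sum_congr rfl fun j _ => h1 j, Finset.sum_add_distrib, hsub.div_free t ht x,
      zero_add]
    exact hdiv t ht x
  · have h1 : dt τ (fun s y => ρ s y * ((ρ s y)⁻¹ • (u s y + ofComponents w s y)) i) t x
        = dt τ (fun s y => u s y i) t x + dt τ (w i) t x := by
      rw [dt_congr (fun s hs y => hm s hs y i) ht x]
      exact dt_add (hu.coord i) (hw i) ht x
    have h2 : dx i (fun y => ρ t y ^ γ / δ ^ 2) x = dx i (fun y => π t y) x := by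
      rw [← dx_add_const (fun y => π t y) (K t / δ ^ 2)]
      congr 1
      ext y
      rw [hpress t ht y]
      field_simp
    -- The flux and the stress are added before differentiating, so the terms with `ρ⁻¹` cancel and
    -- never need the product rule.
    have hsplit : ∀ j,
        dx j (fun y => ρ t y * ((ρ t y)⁻¹ • (u t y + ofComponents w t y)) i
          * ((ρ t y)⁻¹ • (u t y + ofComponents w t y)) j) x
        + dx j (fun y => (R t y
          + (stressDefect u ρ w σ t y + c • (1 : Matrix (Fin n) (Fin n) ℝ))) i j) x
        = u t x j * dx j (fun y => u t y i) x + u t x i * dx j (fun y => u t y j) x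
          + dx j (fun y => R t y i j) x + if i = j then dx i (σ i t) x else 0 := by
      intro j
      have hρv := ((hρ.mul (hv.coord i)).mul (hv.coord j)).differentiableAt ht x
      rw [← dx_add hρv (((hsub.smooth_R.add hRt).entry i j).differentiableAt ht x)]
      have hfun : (fun y => ρ t y * ((ρ t y)⁻¹ • (u t y + ofComponents w t y)) i
            * ((ρ t y)⁻¹ • (u t y + ofComponents w t y)) j
            + (R t y + (stressDefect u ρ w σ t y
              + c • (1 : Matrix (Fin n) (Fin n) ℝ))) i j)
          = fun y => (u t y i * u t y j + R t y i j + if i = j then σ i t y else 0)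
            + c * (1 : Matrix (Fin n) (Fin n) ℝ) i j := by
        ext y
        rw [hm t ht y i, PiLp.smul_apply, PiLp.add_apply, ofComponents_apply, smul_eq_mul]
        simp only [Matrix.add_apply, Matrix.smul_apply, stressDefect, Matrix.of_apply,
          smul_eq_mul]
        ring
      have huu := dx_mul (hui i t ht x) (hui j t ht x) j
      have hRd := (hsub.smooth_R.entry i j).differentiableAt ht x
      have huud := ((hu.coord i).mul (hu.coord j)).differentiableAt ht x
      have huuR : DifferentiableAt ℝ (fun y => u t y i * u t y j + R t y i j) x :=
        huud.add hRd
      rw [hfun, dx_add_const]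
      by_cases hij : i = j
      · subst hij
        simp only [if_true]
        rw [dx_add huuR ((hσ i).differentiableAt ht x), dx_add huud hRd, huu]
      · simp only [if_neg hij, add_zero]
        rw [dx_add huud hRd, huu]
        ring
    have hsum := Finset.sum_congr (rfl : (Finset.univ : Finset (Fin n)) = Finset.univ)
      fun j _ => hsplit j
    simp only [Finset.sum_add_distrib, ← Finset.mul_sum, hsub.div_free t ht x,
      Finset.sum_ite_eq, Finset.mem_univ, if_true, mul_zero, add_zero] at hsum
    have h3 := hsub.momentum t ht x i
    have h4 := hbal i t ht x
    rw [h1, h2]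
    linarith

end Assembly

/-! ### Uniform bounds control the space-time norms. -/

section Norms

variable {n : ℕ} {τ : ℝ} {F : Type*} [NormedAddCommGroup F]

theorem supNorm_le {f : ℝ → E n → F} {C : ℝ}
    (h : ∀ t ∈ Icc 0 τ, ∀ x, ‖f t x‖ ≤ C) : supNorm τ f ≤ ENNReal.ofReal C :=
  iSup₂_le fun t ht => iSup_le fun x => by
    rw [← ofReal_norm]
    exact ENNReal.ofReal_le_ofReal (h t ht x)

theorem measurableSet_spaceTime : MeasurableSet (spaceTime n τ) :=
  measurableSet_Icc.prod measurableSet_unitCube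

theorem volume_spaceTime_lt_top : volume (spaceTime n τ) < ⊤ := by
  rw [spaceTime, Measure.volume_eq_prod, Measure.prod_prod]
  exact ENNReal.mul_lt_top (by simp) volume_unitCube_lt_top

/-- This also serves `p = ⊤`: there `p.toReal⁻¹ = 0`, so the volume factor is 1. -/
theorem LpNorm_le {f : ℝ → E n → F} {C : ℝ} (p : ENNReal)
    (h : ∀ t ∈ Icc 0 τ, ∀ x, ‖f t x‖ ≤ C) :
    LpNorm p τ f ≤ volume (spaceTime n τ) ^ p.toReal⁻¹ * ENNReal.ofReal C := by
  refine (eLpNorm_le_of_ae_bound (C := C) ?_).trans (by simp)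
  exact ae_restrict_of_forall_mem measurableSet_spaceTime fun q hq => h q.1 hq.1 q.2

end Norms

/-! ### The density as a function of `((δ², t), x)`. -/

section Density

variable {n : ℕ} {τ γ s₀ M : ℝ} {π : ℝ → E n → ℝ} {K : ℝ × ℝ → ℝ}

/-- The density as a function of `((δ², t), x)`. -/
noncomputable def densityParam (γ : ℝ) (π : ℝ → E n → ℝ) (K : ℝ × ℝ → ℝ)
    (q : (ℝ × ℝ) × E n) : ℝ :=
  (q.1.1 * π q.1.2 q.2 + K q.1) ^ (1 / γ)

theorem density_eq_densityParam {δ : ℝ} (hδ : 0 < δ) :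
    density γ π δ (fun t => K (δ ^ 2, t)) = fun t x => densityParam γ π K ((δ ^ 2, t), x) := by
  ext t x
  rw [density_eq _ _ _ hδ.ne']
  rfl

theorem base_pos_of_near_one (hπM : ∀ t ∈ Icc 0 τ, ∀ x, ‖π t x‖ ≤ M) (hM : s₀ * M ≤ 1 / 4)
    (hM0 : 0 ≤ M) (hK1 : ∀ y ∈ paramSet s₀ τ, |K y - 1| ≤ y.1 * M) {y : ℝ × ℝ}
    (hy : y ∈ paramSet s₀ τ) (x : E n) : 0 < K y ∧ 0 < y.1 * π y.2 x + K y := by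
  obtain ⟨h1, h2⟩ := abs_mul_le_quarter hπM hM hM0 hy x
  have h3 := abs_le.1 h1
  have h4 := abs_le.1 (hK1 y hy)
  constructor <;> linarith

theorem contDiffOn_densityParam (hπ : SmoothOnTorus τ π) (hKs : ContDiffOn ℝ ∞ K (paramSet s₀ τ))
    (hpos : ∀ y ∈ paramSet s₀ τ, ∀ x, 0 < y.1 * π y.2 x + K y) :
    ContDiffOn ℝ ∞ (densityParam γ π K) (fullSet n s₀ τ) := by
  have h1 : ContDiffOn ℝ ∞ (fun q : (ℝ × ℝ) × E n => π q.1.2 q.2) (fullSet n s₀ τ) :=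
    hπ.1.comp (f := fun q : (ℝ × ℝ) × E n => (q.1.2, q.2)) (by fun_prop)
      fun q hq => ⟨hq.1.2, mem_univ _⟩
  have h2 : ContDiffOn ℝ ∞ (fun q : (ℝ × ℝ) × E n => K q.1) (fullSet n s₀ τ) :=
    hKs.comp contDiff_fst.contDiffOn fun q hq => hq.1
  exact ((contDiff_fst.fst.contDiffOn.mul h1).add h2).rpow_const_of_ne
    fun q hq => (hpos q.1 hq.1 q.2).ne'

theorem periodicOn_densityParam (hπ : SmoothOnTorus τ π) :
    PeriodicOn (paramSet s₀ τ) (densityParam γ π K) := by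
  intro y hy x i
  simp only [densityParam, hπ.2 y.2 hy.2 x i]

theorem iterMean_densityParam (hπ : SmoothOnTorus τ π)
    (hK2 : ∀ y ∈ paramSet s₀ τ, powerMean π (1 / γ) (y, K y) = 1) {p : (ℝ × ℝ) × E n}
    (hp : p ∈ fullSet n s₀ τ) :
    iterMean (axisProd (ℝ × ℝ) n) (densityParam γ π K) n p = 1 := by
  obtain ⟨y, x⟩ := p
  rw [iterMean_prod, (periodicOn_densityParam hπ y hp.1).iterMean_const x 0]
  exact hK2 y hp.1

/-- The bound `|K - 1| ≤ sM` forces `K = 1` at `s = 0`. -/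
theorem densityParam_zero (hK1 : ∀ y ∈ paramSet s₀ τ, |K y - 1| ≤ y.1 * M) (hs : 0 ≤ s₀) {t : ℝ}
    (ht : t ∈ Icc 0 τ) (x : E n) : densityParam γ π K ((0, t), x) = 1 := by
  have h := hK1 (0, t) ⟨⟨le_rfl, hs⟩, ht⟩
  have h1 : K (0, t) = 1 := by
    rw [zero_mul] at h
    exact sub_eq_zero.1 (abs_eq_zero.1 (le_antisymm h (abs_nonneg _)))
  simp [densityParam, h1]

theorem average_varrho_eq_zero {δ t : ℝ} (hπ : SmoothOnTorus τ π)
    (hρ : ContDiffOn ℝ ∞ (densityParam γ π K) (fullSet n s₀ τ))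
    (hK2 : ∀ y ∈ paramSet s₀ τ, powerMean π (1 / γ) (y, K y) = 1)
    (hs : δ ^ 2 ∈ Icc 0 s₀) (ht : t ∈ Icc 0 τ) :
    ⨍ x in unitCube n, varrho γ π δ (fun t => K (δ ^ 2, t)) t x = 0 := by
  have hp := periodicOn_densityParam (γ := γ) (K := K) (s₀ := s₀) hπ (δ ^ 2, t) ⟨hs, ht⟩
  have hc : Continuous fun x => densityParam γ π K ((δ ^ 2, t), x) :=
    (smoothOnTorus_slice hρ (periodicOn_densityParam hπ) hs).continuous_slice ht
  have h1 := hp.iterMean_eq_average hc 0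
  rw [← iterMean_prod, iterMean_densityParam hπ hK2 ⟨⟨hs, ht⟩, mem_univ _⟩] at h1
  have hint : IntegrableOn (fun x => densityParam γ π K ((δ ^ 2, t), x)) (unitCube n) :=
    (hc.continuousOn.integrableOn_compact isBounded_unitCube.isCompact_closure).mono_set
      subset_closure
  have hone : IntegrableOn (fun _ => (1 : ℝ)) (unitCube n) :=
    integrableOn_const volume_unitCube_lt_top.ne
  have hvol : volume.real (unitCube n) ≠ 0 :=
    ENNReal.toReal_ne_zero.2 ⟨volume_unitCube_ne_zero, volume_unitCube_lt_top.ne⟩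
  rw [setAverage_eq, smul_eq_mul] at h1 ⊢
  change _ * ∫ x in unitCube n, (densityParam γ π K ((δ ^ 2, t), x) - 1) / δ ^ 2 = 0
  rw [integral_div, integral_sub hint hone, setIntegral_const, smul_eq_mul, mul_one,
    mul_div_assoc', mul_sub, ← h1, inv_mul_cancel₀ hvol]
  simp

end Density

end LowMach

/-! ### The main theorem: choice of constants and the final estimate. -/

theorem lemma2p2 (n : ℕ) (hn : n = 2 ∨ n = 3) (γ : ℝ) (hγ : 1 < γ)
    (T ε : ℝ) (hε : 0 < ε) (hεT : ε < T)
    (u : ℝ → E n → E n) (π : ℝ → E n → ℝ) (R : ℝ → E n → Matrix (Fin n) (Fin n) ℝ)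
    (hsub : IsIncompressibleSubsolution (T - ε) ε u π R) :
    ∃ δ₀ : ℝ, 0 < δ₀ ∧ ∀ δ : ℝ, 0 < δ → δ ≤ δ₀ →
      ∃ Kstar : ℝ → ℝ, IsNormalizer (T - ε) γ π δ Kstar ∧
        ∃ (v : ℝ → E n → E n) (Rtilde : ℝ → E n → Matrix (Fin n) (Fin n) ℝ),
          SmoothOnTorus (T - ε) v ∧
          SmoothOnTorus (T - ε) Rtilde ∧
          (∀ t ∈ Set.Icc (0 : ℝ) (T - ε), ∀ x : E n, (Rtilde t x).PosDef) ∧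
          IsCompressibleSubsolution (T - ε) γ δ (density γ π δ Kstar) v
            (fun t x => R t x + Rtilde t x) ∧
          supNorm (T - ε) (fun t x => density γ π δ Kstar t x - 1)
            + LpNorm 2 (T - ε) (fun t x => density γ π δ Kstar t x • v t x - u t x)
            + LpNorm ⊤ (T - ε) Rtilde ≤ ENNReal.ofReal ε := by
  set τ := T - ε with hτdef
  have hτ : 0 < τ := sub_pos.2 hεT
  have hγ0 : 0 < γ := zero_lt_one.trans hγ
  have hπ := hsub.smooth_π
  have hu := hsub.smooth_u
  obtain ⟨M, hM0, hπM⟩ := hπ.exists_bound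
  set s₀ : ℝ := 1 / (4 * (M + 1)) with hs₀def
  have hs₀ : 0 < s₀ := by positivity
  have hM : s₀ * M ≤ 1 / 4 := by
    rw [hs₀def, div_mul_eq_mul_div, div_le_div_iff₀ (by positivity) (by norm_num)]
    linarith
  obtain ⟨K, hKs, hK1, hK2⟩ :=
    exists_smooth_normalizer hs₀ hτ (one_div_pos.2 hγ0) hπ hπM hM hM0
  have hbase := fun y (hy : y ∈ paramSet s₀ τ) (x : E n) =>
    base_pos_of_near_one hπM hM hM0 hK1 hy x
  have hρs : ContDiffOn ℝ ∞ (densityParam γ π K) (fullSet n s₀ τ) :=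
    contDiffOn_densityParam hπ hKs fun y hy x => (hbase y hy x).2
  have hρp : PeriodicOn (paramSet s₀ τ) (densityParam γ π K) := periodicOn_densityParam hπ
  have hρ0 : ∀ t ∈ Icc 0 τ, ∀ x, densityParam γ π K ((0, t), x) = 1 := fun t ht x =>
    densityParam_zero hK1 hs₀.le ht x
  have hρpos : ∀ y ∈ paramSet s₀ τ, ∀ x, 0 < densityParam γ π K (y, x) := fun y hy x =>
    Real.rpow_pos_of_pos (hbase y hy x).2 _
  obtain ⟨w, σ, hws, hσs, hwp, hσp, hw0, hσ0, hdiv, hbal⟩ := exists_correction hs₀ hτ hρs hρp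
    (fun p hp => iterMean_densityParam hπ hK2 hp) hρ0
  -- Everything that has to be small, as one function of `((δ², t), x)`.
  set Z : (ℝ × ℝ) × E n → Fin n → Fin n → ℝ := fun q i j =>
    u q.1.2 q.2 i * u q.1.2 q.2 j - (densityParam γ π K q)⁻¹
      * ((u q.1.2 q.2 i + w i q) * (u q.1.2 q.2 j + w j q)) + if i = j then σ i q else 0 with hZ
  set Φ : (ℝ × ℝ) × E n → ℝ × (Fin n → ℝ) × (Fin n → Fin n → ℝ) := fun q =>
    (densityParam γ π K q - 1, fun i => w i q, Z q) with hΦ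
  have huc : ∀ i, ContinuousOn (fun q : (ℝ × ℝ) × E n => u q.1.2 q.2 i) (fullSet n s₀ τ) :=
    fun i => (hu.coord i).1.continuousOn.comp (f := fun q : (ℝ × ℝ) × E n => (q.1.2, q.2))
      (by fun_prop) fun q hq => ⟨hq.1.2, mem_univ _⟩
  have hZc : ContinuousOn Z (fullSet n s₀ τ) := by
    refine continuousOn_pi.2 fun i => continuousOn_pi.2 fun j => ?_
    refine (((huc i).mul (huc j)).sub ((hρs.continuousOn.inv₀
      fun q hq => (hρpos q.1 hq.1 q.2).ne').mul (((huc i).add (hws i).continuousOn).mul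
        ((huc j).add (hws j).continuousOn)))).add ?_
    split_ifs
    · exact (hσs i).continuousOn
    · exact continuousOn_const
  have hΦc : ContinuousOn Φ (fullSet n s₀ τ) :=
    (hρs.continuousOn.sub continuousOn_const).prodMk
      ((continuousOn_pi.2 fun i => (hws i).continuousOn).prodMk hZc)
  have hΦp : PeriodicOn (paramSet s₀ τ) Φ := by
    intro y hy x k
    have h1 := hρp y hy x k
    have h2 := fun i => hwp i y hy x k
    have h3 := fun i => hσp i y hy x k
    have h4 := hu.2 y.2 hy.2 x k
    simp only at h1 h2 h3 h4
    simp only [hΦ, hZ, h1, h2, h3, h4]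
  have hΦ0 : ∀ t ∈ Icc 0 τ, ∀ x, Φ ((0, t), x) = 0 := by
    intro t ht x
    simp only [hΦ, hZ, hρ0 t ht x, fun i => hw0 i t ht x, fun i => hσ0 i t ht x]
    refine Prod.ext (by simp) (Prod.ext (by ext; simp) ?_)
    ext i j
    simp
  -- The smallness threshold.
  set c : ℝ := ε / (4 * (‖(1 : Matrix (Fin n) (Fin n) ℝ)‖ + 1)) with hc
  have hc0 : 0 < c := by positivity
  set B : ℝ := ∑ i : Fin n, ∑ j : Fin n, ‖Matrix.single i j (1 : ℝ)‖ with hB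
  have hB0 : 0 ≤ B := by positivity
  set V : ENNReal := volume (spaceTime n τ) ^ (2 : ENNReal).toReal⁻¹ with hV
  have hVtop : V ≠ ⊤ := (ENNReal.rpow_lt_top_of_nonneg (by positivity)
    volume_spaceTime_lt_top.ne).ne
  have hV0 : 0 ≤ V.toReal := ENNReal.toReal_nonneg
  -- The budget `ε` is split into quarters: density, momentum, stress defect and `c Id`. The
  -- condition `n * η < c` gives positive definiteness.
  obtain ⟨η, hη0, hη1, hη2, hη3, hη4⟩ : ∃ η : ℝ, 0 < η ∧ η ≤ ε / 4 ∧ V.toReal * (n * η) ≤ ε / 4 ∧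
      n * η < c ∧ η * B ≤ ε / 4 := by
    have hsmall : ∀ a b : ℝ, 0 < b → ∀ᶠ η in nhdsWithin (0 : ℝ) (Ioi 0), a * η < b := by
      intro a b hb
      have : Filter.Tendsto (fun η : ℝ => a * η) (nhdsWithin 0 (Ioi 0)) (nhds (a * 0)) :=
        ((continuous_const_mul a).tendsto 0).mono_left nhdsWithin_le_nhds
      rw [mul_zero] at this
      exact this.eventually (gt_mem_nhds hb)
    obtain ⟨η, h⟩ := (((((hsmall 1 (ε / 4) (by positivity)).and
      (hsmall (V.toReal * n) (ε / 4) (by positivity))).and (hsmall n c hc0)).and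
      (hsmall B (ε / 4) (by positivity))).and self_mem_nhdsWithin).exists
    obtain ⟨⟨⟨⟨h1, h2⟩, h3⟩, h4⟩, h5⟩ := h
    exact ⟨η, h5, by linarith, by linarith, h3, by linarith⟩
  obtain ⟨s₁, hs₁, hs₁₀, hΦη⟩ := exists_uniformly_small hΦc hΦp hs₀ hΦ0 hη0
  -- The parameter is `s = δ²`, hence the square root.
  refine ⟨√s₁, Real.sqrt_pos.2 hs₁, fun δ hδ hδ₀ => ?_⟩
  have hs1 : δ ^ 2 ∈ Icc 0 s₁ := ⟨sq_nonneg _, by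
    rw [← Real.sq_sqrt hs₁.le]
    exact pow_le_pow_left₀ hδ.le hδ₀ 2⟩
  have hs : δ ^ 2 ∈ Icc 0 s₀ := ⟨hs1.1, hs1.2.trans hs₁₀⟩
  have hb := hΦη (δ ^ 2) hs1
  have hbρ : ∀ t ∈ Icc 0 τ, ∀ x, ‖densityParam γ π K ((δ ^ 2, t), x) - 1‖ ≤ η :=
    fun t ht x => (norm_fst_le (Φ ((δ ^ 2, t), x))).trans (hb t ht x).le
  have hbw : ∀ t ∈ Icc 0 τ, ∀ x, ∀ i, |w i ((δ ^ 2, t), x)| ≤ η := fun t ht x i =>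
    (norm_le_pi_norm (Φ ((δ ^ 2, t), x)).2.1 i).trans ((norm_fst_le _).trans
      ((norm_snd_le (Φ ((δ ^ 2, t), x))).trans (hb t ht x).le))
  set ρ : ℝ → E n → ℝ := fun t x => densityParam γ π K ((δ ^ 2, t), x) 
  set w' : Fin n → ℝ → E n → ℝ := fun i t x => w i ((δ ^ 2, t), x) with hw'
  set σ' : Fin n → ℝ → E n → ℝ := fun i t x => σ i ((δ ^ 2, t), x) with hσ'
  -- At `s = δ²` the last component of `Φ` is the stress defect by definition.
  have hbZ : ∀ t ∈ Icc 0 τ, ∀ x, ∀ i j, |stressDefect u ρ w' σ' t x i j| ≤ η :=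
    fun t ht x i j => (norm_le_pi_norm ((Φ ((δ ^ 2, t), x)).2.2 i) j).trans
      ((norm_le_pi_norm (Φ ((δ ^ 2, t), x)).2.2 i).trans ((norm_snd_le _).trans
      ((norm_snd_le (Φ ((δ ^ 2, t), x))).trans (hb t ht x).le)))
  have hρS : SmoothOnTorus τ ρ := smoothOnTorus_slice hρs hρp hs
  have hwS : ∀ i, SmoothOnTorus τ (w' i) := fun i => smoothOnTorus_slice (hws i) (hwp i) hs
  have hσS : ∀ i, SmoothOnTorus τ (σ' i) := fun i => smoothOnTorus_slice (hσs i) (hσp i) hs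
  have hpos : ∀ t ∈ Icc 0 τ, ∀ x, 0 < ρ t x := fun t ht x => hρpos (δ ^ 2, t) ⟨hs, ht⟩ x
  have hpd : ∀ t ∈ Icc 0 τ, ∀ x,
      (stressDefect u ρ w' σ' t x + c • (1 : Matrix (Fin n) (Fin n) ℝ)).PosDef := fun t ht x =>
    posDef_add_smul_one (stressDefect_isSymm t x) (hbZ t ht x) hη3
  refine ⟨fun t => K (δ ^ 2, t), ⟨fun t ht => (hbase (δ ^ 2, t) ⟨hs, ht⟩ 0).1,
    fun t ht x => (hbase (δ ^ 2, t) ⟨hs, ht⟩ x).2,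
    fun t ht => average_varrho_eq_zero hπ hρs hK2 hs ht⟩,
    fun t x => (ρ t x)⁻¹ • (u t x + ofComponents w' t x),
    fun t x => stressDefect u ρ w' σ' t x + c • (1 : Matrix (Fin n) (Fin n) ℝ),
    smoothOnTorus_velocity hu hρS hpos hwS,
    (smoothOnTorus_stressDefect hu hρS hpos hwS hσS).add (smoothOnTorus_const _), hpd, ?_, ?_⟩
  · rw [density_eq_densityParam hδ]
    refine isCompressibleSubsolution_of_correction (K := fun t => K (δ ^ 2, t)) hsub hε hδ hρS
      hpos (fun t ht x => ?_) hwS hσS (hdiv _ hs) (fun i => hbal i _ hs) hpd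
    have h := (hbase (δ ^ 2, t) ⟨hs, ht⟩ x).2
    simp only [densityParam]
    rw [← Real.rpow_mul h.le, one_div_mul_cancel hγ0.ne', Real.rpow_one]
  · rw [density_eq_densityParam hδ]
    have h1 : supNorm τ (fun t x => ρ t x - 1) ≤ ENNReal.ofReal (ε / 4) :=
      supNorm_le fun t ht x => (hbρ t ht x).trans hη1
    have h2 : LpNorm 2 τ (fun t x => ρ t x • ((ρ t x)⁻¹ • (u t x + ofComponents w' t x)) - u t x)
        ≤ ENNReal.ofReal (ε / 4) := by
      refine (LpNorm_le (C := n * η) 2 fun t ht x => ?_).trans ?_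
      · rw [smul_inv_smul₀ (hpos t ht x).ne', add_sub_cancel_left]
        exact norm_ofComponents_le (hbw t ht x)
      · rw [← hV, ← ENNReal.ofReal_toReal hVtop, ← ENNReal.ofReal_mul hV0]
        exact ENNReal.ofReal_le_ofReal hη2
    have h3 : LpNorm ⊤ τ
        (fun t x => stressDefect u ρ w' σ' t x + c • (1 : Matrix (Fin n) (Fin n) ℝ))
        ≤ ENNReal.ofReal (ε / 2) := by
      refine (LpNorm_le (C := ε / 2) ⊤ fun t ht x => ?_).trans (by simp)
      refine (norm_add_le _ _).trans ?_
      have h4 := norm_matrix_le (hbZ t ht x)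
      have h5 : ‖c • (1 : Matrix (Fin n) (Fin n) ℝ)‖ ≤ ε / 4 := by
        rw [norm_smul, Real.norm_of_nonneg hc0.le, hc, div_mul_eq_mul_div,
          div_le_div_iff₀ (by positivity) (by norm_num)]
        nlinarith [norm_nonneg (1 : Matrix (Fin n) (Fin n) ℝ)]
      linarith
    refine (add_le_add (add_le_add h1 h2) h3).trans ?_
    rw [← ENNReal.ofReal_add (by positivity) (by positivity),
      ← ENNReal.ofReal_add (by positivity) (by positivity)]
    exact ENNReal.ofReal_le_ofReal (by linarith)
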